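/- All graphs are finite and simple, and all costs and weights are non-negative. For a graph $G=(V,E)$ with edge costs $c\colon E\to\mathbb R_{\ge 0}$ let $\delta(U)$ be the set of edges with exactly one endpoint in $U\subseteq V$, and $\tau(v):=c(\delta(\{v\}))$. Write $f(S):=\sum_{x\in S}f(x)$, $\|f\|_p:=(\sum_x f(x)^p)^{1/p}$, $\|f\|_\infty:=\max_x f(x)$. - $(G,c)$ is *well-behaved* with bounds $\Delta,\varphi$ if the maximum degree of $G$ is at most $\Delta$ and the local fluctuation $\max_{u\in e\in E}\tau(u)/c(e)$ is at most $\varphi$ (with $0/0=0$). - A *separation* of a graph $H$ is a pair $(A,B)$ of vertex sets with $A\cup B=V(H)$ and no edge between $A\setminus B$ and $B\setminus A$. It is *$w$-balanced* if $w(A\setminus B)$ and $w(B\setminus A)$ are at most $\frac23\|w\|_1$; its cost is $\tau(A\cap B)$. - The *$p$-separability* of $(G,\tau)$ is $\beta_p(G,\tau):=\max_{W\subseteq V}\sup_{w\colon W\to\mathbb R_{\ge 0}}\min_{(A,B)}\tau(A\cap B)/\|\tau|_W\|_p$, where the minimum is over the $w$-balanced separations of $G[W]$. A family of instances has a *$p$-separator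 theorem* if $\beta_p$ is bounded by a constant on the family. - A $k$-coloring $\chi\colon V\to[k]$ is *strictly $w$-balanced* if $\bigl|w(\chi^{-1}(i))-\|w\|_1/k\bigr|\le(1-\frac1k)\|w\|_\infty$ for all $i$, and *roughly $w$-balanced* if $w(\chi^{-1}(i))\le 2\|w\|_1/k$ for all $i$. Its maximum (average) boundary cost is the maximum (average) of $c(\delta(\chi^{-1}(i)))$ over $i\in[k]$. - $\partial^k_\infty(G,c)$ is the supremum over all weights $w\colon V\to\mathbb R_{\ge0}$ of the minimum, over all strictly $w$-balanced $k$-colorings $\chi$ of $G$, of the maximum boundary cost of $\chi$. **Statement.** Let $\Delta\in\mathbb N$, $\varphi,\beta\ge 0$ and $b>0$. There is a constant $C_0>0$ depending only on $\Delta,\varphi,\beta,b$, and for every real $p>1$ there are constants $\beta',C_1,C_2$ with $C_1>0$ depending only on $p,\Delta,\varphi,\beta,b$, such that the following holds. Let $(G,c)$ be well-behaved with bounds $\Delta,\varphi$, let $\beta_p(G,\tau)\le\beta$, and let $w\colon V\to\mathbb R_{\ge0}$ be weights with $\|w\|_\infty\le\|w\|_1/4$ such that every $w$-balanced separation of $G$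 has cost at least $b\,\|\tau\|_p$. Let $k$ be a positive multiple of $4$, let $\tilde G$ be the disjoint union of $k/4$ copies of $G$, and let $\tilde c,\tilde w$ be the edge costs and vertex weights on $\tilde G$ copied from $c,w$. Then $(\tilde G,\tilde c)$ is well-behaved with bounds $\Delta,\varphi$; it satisfies $\beta_p(\tilde G,\tilde\tau)\le\beta'$, where $\tilde\tau(v):=\tilde c(\delta(\{v\}))$; $$C_1\Bigl(\frac{\|\tilde c\|_p}{k^{1/p}}+\|\tilde c\|_\infty\Bigr)\le\partial^k_\infty(\tilde G,\tilde c)\le C_2\Bigl(\frac{\|\tilde c\|_p}{k^{1/p}}+\|\tilde c\|_\infty\Bigr);$$ and every roughly $\tilde w$-balanced $k$-coloring of $\tilde G$ has average boundary cost at least $C_0\bigl(\|\tilde c\|_p/k^{1/p}+\|\tilde c\|_\infty\bigr)$. -/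

import Mathlib

open scoped NNReal ENNReal

noncomputable section

namespace MinMaxBoundary

/-- Total value `f(S) = ∑ x ∈ S, f x`. -/
def total {X : Type*} (f : X → ℝ≥0) (S : Finset X) : ℝ≥0 := ∑ x ∈ S, f x

/-- The `p`-norm of the restriction of `f` to the finite set `S`. -/
def pNorm {X : Type*} (p : ℝ) (f : X → ℝ≥0) (S : Finset X) : ℝ≥0 :=
  (∑ x ∈ S, f x ^ p) ^ (1 / p)

/-- The maximum of `f` over the finite set `S` (`0` if `S` is empty). -/
def maxNorm {X : Type*} (f : X → ℝ≥0) (S : Finset X) : ℝ≥0 := S.sup f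

section Graph

variable {V : Type*} [Fintype V]

open Classical in
/-- The edge set of a finite graph, as a finset. Edge costs are functions `c : Sym2 V → ℝ≥0`
of which only the values on this set are ever used. -/
def edges (G : SimpleGraph V) : Finset (Sym2 V) :=
  Finset.univ.filter fun e => e ∈ G.edgeSet

open Classical in
/-- The cut `δ(U)`: the edges with exactly one endpoint in `U`. -/
def cut (G : SimpleGraph V) (U : Finset V) : Finset (Sym2 V) :=
  (edges G).filter fun e => (∃ u ∈ e, u ∈ U) ∧ (∃ v ∈ e, v ∉ U)

/-- The boundary cost `∂U = c(δ(U))`. -/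
def boundaryCost (G : SimpleGraph V) (c : Sym2 V → ℝ≥0) (U : Finset V) : ℝ≥0 :=
  total c (cut G U)

/-- The vertex costs `τ(v) = c(δ(v))` that correspond to the edge costs `c`. -/
def vertexCost (G : SimpleGraph V) (c : Sym2 V → ℝ≥0) (v : V) : ℝ≥0 :=
  boundaryCost G c {v}

/-- The local fluctuation `max_{u ∈ e ∈ E} τ(u) / c(e)`. In `ℝ≥0∞` one has `x / 0 = ∞` for
`x ≠ 0`, and `0 / 0 = 0`. -/
def localFluctuation (G : SimpleGraph V) (c : Sym2 V → ℝ≥0) : ℝ≥0∞ :=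
  ⨆ e ∈ edges G, ⨆ u ∈ e, (vertexCost G c u : ℝ≥0∞) / (c e : ℝ≥0∞)

open Classical in
/-- The instance `(G, c)` is well-behaved with bounds `Δ` and `φ`: the maximum degree is at most
`Δ` and the local fluctuation of the costs is at most `φ`. -/
def WellBehaved (G : SimpleGraph V) (c : Sym2 V → ℝ≥0) (Δ : ℕ) (φ : ℝ≥0) : Prop :=
  G.maxDegree ≤ Δ ∧ localFluctuation G c ≤ φ

open Classical in
/-- `(A, B)` is a separation of the induced subgraph `G[W]` that is balanced with respect to the
weights `w` (restricted to `W`). -/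
def IsBalancedSeparation (G : SimpleGraph V) (W : Finset V) (w : V → ℝ≥0)
    (A B : Finset V) : Prop :=
  A ∪ B = W ∧
  (∀ a ∈ A \ B, ∀ b ∈ B \ A, ¬ G.Adj a b) ∧
  total w (A \ B) ≤ 2 / 3 * total w W ∧
  total w (B \ A) ≤ 2 / 3 * total w W

open Classical in
/-- The cost `τ(A ∩ B)` of a separation `(A, B)`. -/
def separationCost (τ : V → ℝ≥0) (A B : Finset V) : ℝ≥0 := total τ (A ∩ B)

/-- The `p`-separability `β_p(G, τ)`: the worst case, over the induced subgraphs `G[W]` and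
weights `w`, of the least cost of a `w`-balanced separation of `G[W]` relative to the `p`-norm of
`τ` on `W`. -/
def separability (p : ℝ) (G : SimpleGraph V) (τ : V → ℝ≥0) : ℝ≥0∞ :=
  ⨆ (W : Finset V) (w : V → ℝ≥0), ⨅ (A : Finset V) (B : Finset V)
    (_ : IsBalancedSeparation G W w A B),
      (separationCost τ A B : ℝ≥0∞) / (pNorm p τ W : ℝ≥0∞)

open Classical in
/-- The color class `χ⁻¹(i)`. -/
def colorClass {k : ℕ} (χ : V → Fin k) (i : Fin k) : Finset V :=
  Finset.univ.filter fun v => χ v = i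

/-- The coloring `χ` is strictly `w`-balanced: each class weight differs from the average
`‖w‖₁ / k` by at most `(1 - 1/k) ‖w‖_∞`. -/
def StrictlyBalanced {k : ℕ} (w : V → ℝ≥0) (χ : V → Fin k) : Prop :=
  ∀ i, |(total w (colorClass χ i) : ℝ) - (total w Finset.univ : ℝ) / k|
    ≤ (1 - 1 / (k : ℝ)) * (maxNorm w Finset.univ : ℝ)

/-- The coloring `χ` is roughly `w`-balanced: each class weight is at most twice the average. -/
def RoughlyBalanced {k : ℕ} (w : V → ℝ≥0) (χ : V → Fin k) : Prop :=
  ∀ i, total w (colorClass χ i) ≤ 2 * (total w Finset.univ / k)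

/-- The maximum boundary cost of a coloring. -/
def maxBoundaryCost {k : ℕ} (G : SimpleGraph V) (c : Sym2 V → ℝ≥0) (χ : V → Fin k) : ℝ≥0 :=
  maxNorm (fun i => boundaryCost G c (colorClass χ i)) Finset.univ

/-- The average boundary cost of a coloring. -/
def avgBoundaryCost {k : ℕ} (G : SimpleGraph V) (c : Sym2 V → ℝ≥0) (χ : V → Fin k) : ℝ≥0 :=
  total (fun i => boundaryCost G c (colorClass χ i)) Finset.univ / k

/-- The min-max boundary `k`-decomposition cost `∂^k_∞(G, c)`: the supremum over all weights `w`
of the least maximum boundary cost of a strictly `w`-balanced `k`-coloring. -/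
def decompositionCost (k : ℕ) (G : SimpleGraph V) (c : Sym2 V → ℝ≥0) : ℝ≥0∞ :=
  ⨆ w : V → ℝ≥0, ⨅ (χ : V → Fin k) (_ : StrictlyBalanced w χ), (maxBoundaryCost G c χ : ℝ≥0∞)

/-- The quantity `‖c‖_p / k^{1/p} + ‖c‖_∞`. -/
def costBound (p : ℝ) (k : ℕ) (G : SimpleGraph V) (c : Sym2 V → ℝ≥0) : ℝ≥0 :=
  pNorm p c (edges G) / (k : ℝ≥0) ^ (1 / p) + maxNorm c (edges G)

end Graph

section Copies

variable {V : Type*}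

/-- The disjoint union of `m` isomorphic copies of `G`; `(i, v)` is the copy of `v` in the `i`-th
one. -/
def copies (m : ℕ) (G : SimpleGraph V) : SimpleGraph (Fin m × V) where
  Adj x y := x.1 = y.1 ∧ G.Adj x.2 y.2
  symm := ⟨fun _ _ h => ⟨h.1.symm, h.2.symm⟩⟩
  loopless := ⟨fun _ h => G.irrefl h.2⟩

/-- Each edge of a copy has the cost of the corresponding edge of `G`. -/
def copiesCost (m : ℕ) (c : Sym2 V → ℝ≥0) : Sym2 (Fin m × V) → ℝ≥0 :=
  fun e => c (e.map Prod.snd)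

/-- Each vertex of a copy has the weight of the corresponding vertex of `G`. -/
def copiesWeight (m : ℕ) (w : V → ℝ≥0) : Fin m × V → ℝ≥0 :=
  fun x => w x.2

end Copies

end MinMaxBoundary

end

open MinMaxBoundary

/-! Put `m = k / 4`. All quantities in the theorem are comparable to `‖c‖_p`, independently of `k`:
since `‖c̃‖_p = m^(1/p) ‖c‖_p` and `‖c̃‖_∞ ≤ ‖c‖_p`, the cost bound lies between `‖c‖_p / 4` and `2
‖c‖_p` (`quarter_mul_pNorm_le_costBound`), and bounded degree makes `‖τ‖_p` comparable to `‖c‖_p`.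

Lower bounds: in a roughly balanced coloring every class weighs at most `2m‖w‖₁ / (4m) = ‖w‖₁ / 2`,
so no color dominates any copy. In each copy the vertices with a neighbour of another color form a
separator, and the color classes that remain can be grouped into two balanced sides. This separation
costs at least `b ‖τ‖_p`, while bounded fluctuation charges it to the bichromatic edges
(`separation_le_cut_of_labels`). Summing over the `m` copies and dividing by `k = 4m` bounds the
average boundary cost (`le_avgBoundaryCost`). Strictly balanced colorings are roughly balanced here
and the maximum is at least the average, so the decomposition cost is bounded below as well.

Upper bound: recursive separation with the weights `τ^p` arranges `V` on a line. Any cut of the line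
meets only one part at each level of the recursion, so its cost is a geometric sum, which is
`O(‖τ‖_p)` (`exists_layout`). Concatenating the layouts of the copies does not raise the largest
cut. Any weighted line can be divided into `k` strictly balanced intervals, and the boundary of an
interval lies in two cuts (`exists_strictlyBalanced_of_layout`). -/

namespace MinMaxBoundary

/-! ### Edge sums as sums over ordered pairs of vertices; comparison of `‖τ‖_p` with `‖c‖_p`. -/

section Pairs

variable {V : Type*}

open Classical in
/-- The cost of the edge between `u` and `v`, or `0` if there is none. -/
noncomputable def pairCost (G : SimpleGraph V) (c : Sym2 V → ℝ≥0) (u v : V) : ℝ≥0 :=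
  if G.Adj u v then c s(u, v) else 0

lemma pairCost_comm (G : SimpleGraph V) (c : Sym2 V → ℝ≥0) (u v : V) :
    pairCost G c u v = pairCost G c v u := by
  classical
  rw [pairCost, pairCost, Sym2.eq_swap]
  exact if_congr (G.adj_comm u v) rfl rfl

variable [Fintype V]

open Classical in
-- A cut edge has exactly one orientation that leaves `U`, so no factor 2 appears.
lemma boundaryCost_eq_sum (G : SimpleGraph V) (c : Sym2 V → ℝ≥0) (U : Finset V) :
    boundaryCost G c U = ∑ u ∈ U, ∑ v ∈ Uᶜ, pairCost G c u v := by
  rw [boundaryCost, total, ← Finset.sum_product']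
  simp only [pairCost]
  rw [← Finset.sum_filter]
  symm
  refine Finset.sum_bij (fun x _ => s(x.1, x.2)) ?_ ?_ ?_ ?_
  · rintro ⟨u, v⟩ h
    simp only [Finset.mem_filter, Finset.mem_product, Finset.mem_compl] at h
    simp only [cut, edges, Finset.mem_filter, Finset.mem_univ, true_and,
      SimpleGraph.mem_edgeSet]
    exact ⟨h.2, ⟨u, by simp, h.1.1⟩, ⟨v, by simp, h.1.2⟩⟩
  · rintro ⟨u, v⟩ h ⟨u', v'⟩ h' he
    simp only [Finset.mem_filter, Finset.mem_product, Finset.mem_compl] at h h'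
    rcases Sym2.eq_iff.1 he with ⟨h1, h2⟩ | ⟨h1, h2⟩
    · exact Prod.ext h1 h2
    · exact absurd h.1.1 (by rw [show u = v' from h1]; exact h'.1.2)
  · intro e he
    induction e with | _ u v =>
    simp only [cut, edges, Finset.mem_filter, Finset.mem_univ, true_and,
      SimpleGraph.mem_edgeSet, Sym2.mem_iff] at he
    obtain ⟨hadj, ⟨x, hx, hxU⟩, ⟨y, hy, hyU⟩⟩ := he
    by_cases hu : u ∈ U
    · have hv : v ∉ U := by rcases hy with rfl | rfl <;> tauto
      exact ⟨(u, v), by simp [hu, hv, hadj], rfl⟩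
    · have hv : v ∈ U := by rcases hx with rfl | rfl <;> tauto
      exact ⟨(v, u), by simp [hu, hv, hadj.symm], Sym2.eq_swap⟩
  · intro _ _; rfl

lemma vertexCost_eq_sum (G : SimpleGraph V) (c : Sym2 V → ℝ≥0) (u : V) :
    vertexCost G c u = ∑ v, pairCost G c u v := by
  classical
  rw [vertexCost, boundaryCost_eq_sum, Finset.sum_singleton]
  refine Finset.sum_subset (Finset.subset_univ _) fun v _ hv => ?_
  have : v = u := by simpa using hv
  simp [pairCost, this]

open Classical in
lemma sum_sum_adj (G : SimpleGraph V) (F : Sym2 V → ℝ≥0) :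
    ∑ u, ∑ v, (if G.Adj u v then F s(u, v) else 0) = 2 * ∑ e ∈ edges G, F e := by
  rw [← Finset.sum_product', ← Finset.sum_filter, Finset.mul_sum,
    ← Finset.sum_fiberwise_of_maps_to (t := edges G) (g := fun x : V × V => s(x.1, x.2))]
  · refine Finset.sum_congr rfl fun e he => ?_
    induction e with | _ a b =>
    have hab : G.Adj a b := by simpa [edges] using he
    have : ((Finset.univ ×ˢ Finset.univ : Finset (V × V)).filter
        (fun x => G.Adj x.1 x.2)).filter (fun x => s(x.1, x.2) = s(a, b)) =
        {(a, b), (b, a)} := by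
      ext ⟨x, y⟩
      simp only [Finset.mem_filter, Finset.mem_product, Finset.mem_univ, true_and,
        Sym2.eq_iff, Finset.mem_insert, Finset.mem_singleton, Prod.mk.injEq]
      constructor
      · exact fun h => h.2
      · rintro (⟨rfl, rfl⟩ | ⟨rfl, rfl⟩)
        · exact ⟨hab, by simp⟩
        · exact ⟨hab.symm, by simp⟩
    rw [this, Finset.sum_pair (by simpa using fun h => absurd h hab.ne)]
    simp only [Sym2.eq_swap (a := b) (b := a)]
    ring
  · rintro ⟨u, v⟩ h
    simpa [edges] using h

lemma sum_sum_pairCost_rpow (G : SimpleGraph V) (c : Sym2 V → ℝ≥0) {p : ℝ} (hp : 0 < p) :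
    ∑ u, ∑ v, pairCost G c u v ^ p = 2 * ∑ e ∈ edges G, c e ^ p := by
  classical
  rw [← sum_sum_adj]
  refine Finset.sum_congr rfl fun u _ => Finset.sum_congr rfl fun v _ => ?_
  simp only [pairCost]
  split_ifs
  · rfl
  · exact NNReal.zero_rpow hp.ne'

/-- Finiteness of the fluctuation forces `τ(u) = 0` on edges of cost `0`, so the product form holds
for these edges too. -/
lemma vertexCost_le_mul (G : SimpleGraph V) (c : Sym2 V → ℝ≥0) {Δ : ℕ} {φ : ℝ≥0}
    (h : WellBehaved G c Δ φ) {u v : V} (huv : G.Adj u v) :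
    vertexCost G c u ≤ φ * pairCost G c u v := by
  classical
  have h1 : (vertexCost G c u : ℝ≥0∞) / (c s(u, v) : ℝ≥0∞) ≤ φ := by
    refine le_trans ?_ h.2
    refine le_trans ?_ (le_iSup₂ (f := fun e (_ : e ∈ edges G) =>
      ⨆ u ∈ e, (vertexCost G c u : ℝ≥0∞) / (c e : ℝ≥0∞)) s(u, v) (by simpa [edges] using huv))
    exact le_iSup₂ (f := fun x (_ : x ∈ s(u, v)) =>
      (vertexCost G c x : ℝ≥0∞) / (c s(u, v) : ℝ≥0∞)) u (by simp)
  rw [pairCost, if_pos huv]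
  rw [ENNReal.div_le_iff_le_mul (Or.inr ENNReal.coe_ne_top) (Or.inl ENNReal.coe_ne_top)] at h1
  exact_mod_cast h1

lemma pNorm_rpow {X : Type*} {p : ℝ} (hp : 0 < p) (f : X → ℝ≥0) (S : Finset X) :
    pNorm p f S ^ p = ∑ x ∈ S, f x ^ p := by
  rw [pNorm, ← NNReal.rpow_mul, one_div_mul_cancel hp.ne', NNReal.rpow_one]

lemma sum_rpow_le_rpow_sum {X : Type*} {p : ℝ} (hp : 1 ≤ p) (f : X → ℝ≥0) (S : Finset X) :
    ∑ x ∈ S, f x ^ p ≤ (∑ x ∈ S, f x) ^ p := by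
  classical
  induction S using Finset.induction_on with
  | empty => simp
  | insert a S ha ih =>
    rw [Finset.sum_insert ha, Finset.sum_insert ha]
    exact (add_le_add_right ih _).trans (NNReal.add_rpow_le_rpow_add _ _ hp)

lemma pNorm_edges_le (G : SimpleGraph V) (c : Sym2 V → ℝ≥0) {p : ℝ} (hp : 1 < p) :
    pNorm p c (edges G) ≤ pNorm p (vertexCost G c) Finset.univ := by
  have hp0 : 0 < p := by linarith
  refine NNReal.rpow_le_rpow ?_ (by positivity)
  calc ∑ e ∈ edges G, c e ^ p ≤ 2 * ∑ e ∈ edges G, c e ^ p :=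
        le_mul_of_one_le_left' (by norm_num)
    _ = ∑ u, ∑ v, pairCost G c u v ^ p := (sum_sum_pairCost_rpow G c hp0).symm
    _ ≤ _ := by
        refine Finset.sum_le_sum fun u _ => ?_
        rw [vertexCost_eq_sum]
        exact sum_rpow_le_rpow_sum hp.le _ _

open Classical in
lemma pNorm_vertexCost_le (G : SimpleGraph V) (c : Sym2 V → ℝ≥0) {p : ℝ} (hp : 1 < p) {Δ : ℕ}
    (hΔ : G.maxDegree ≤ Δ) :
    pNorm p (vertexCost G c) Finset.univ ≤ 2 * (Δ + 1) * pNorm p c (edges G) := by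
  have hp0 : 0 < p := by linarith
  -- The sum over at most `Δ` incident edges is controlled by the most expensive one.
  have key : ∀ u, vertexCost G c u ^ p ≤ (Δ + 1 : ℝ≥0) ^ p * ∑ v, pairCost G c u v ^ p := by
    intro u
    obtain ⟨v, -, hv⟩ := Finset.exists_max_image Finset.univ (pairCost G c u) ⟨u, by simp⟩
    have h1 : vertexCost G c u ≤ (Δ + 1) * pairCost G c u v := by
      rw [vertexCost_eq_sum]
      calc ∑ x, pairCost G c u x = ∑ x ∈ G.neighborFinset u, pairCost G c u x := by
            symm
            refine Finset.sum_subset (Finset.subset_univ _) fun x _ hx => ?_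
            rw [SimpleGraph.mem_neighborFinset] at hx
            simp [pairCost, hx]
        _ ≤ (G.neighborFinset u).card • pairCost G c u v :=
            Finset.sum_le_card_nsmul _ _ _ fun x _ => hv x (Finset.mem_univ x)
        _ ≤ (Δ + 1) * pairCost G c u v := by
            rw [nsmul_eq_mul]
            gcongr
            have : G.degree u ≤ Δ := (G.degree_le_maxDegree u).trans hΔ
            rw [SimpleGraph.card_neighborFinset_eq_degree]
            exact_mod_cast this.trans (Nat.le_succ _)
    calc vertexCost G c u ^ p ≤ ((Δ + 1) * pairCost G c u v) ^ p :=
          NNReal.rpow_le_rpow h1 hp0.le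
      _ = (Δ + 1 : ℝ≥0) ^ p * pairCost G c u v ^ p := NNReal.mul_rpow
      _ ≤ _ := by
          gcongr
          exact Finset.single_le_sum (f := fun v => pairCost G c u v ^ p) (fun _ _ => zero_le)
            (Finset.mem_univ v)
  rw [← NNReal.rpow_le_rpow_iff hp0, NNReal.mul_rpow, pNorm_rpow hp0, pNorm_rpow hp0,
    NNReal.mul_rpow]
  calc ∑ u, vertexCost G c u ^ p ≤ ∑ u, (Δ + 1 : ℝ≥0) ^ p * ∑ v, pairCost G c u v ^ p :=
        Finset.sum_le_sum fun u _ => key u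
    _ = 2 * (Δ + 1 : ℝ≥0) ^ p * ∑ e ∈ edges G, c e ^ p := by
        rw [← Finset.mul_sum, sum_sum_pairCost_rpow G c hp0]; ring
    _ ≤ _ := by
        gcongr
        -- Each edge is counted at both ends; this factor is absorbed by `2 ≤ 2 ^ p`.
        exact_mod_cast Real.self_le_rpow_of_one_le (x := 2) (by norm_num) hp.le

end Pairs

/-! ### Cutting a sequence into consecutive blocks of nearly equal sum. -/

section Blocks

/-- The least index `t' ≥ t` at which `P` has grown by `s`, or `t` if there is none. -/
noncomputable def nextCut (P : ℕ → ℝ) (s : ℝ) (t : ℕ) : ℕ := sInf {t' | t ≤ t' ∧ P t + s ≤ P t'}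

/-- The ends of the greedy blocks of sum at least `s`. -/
noncomputable def greedyCut (P : ℕ → ℝ) (s : ℝ) : ℕ → ℕ
  | 0 => 0
  | j + 1 => nextCut P s (greedyCut P s j)

variable {P : ℕ → ℝ} {M : ℝ}

/-- Unboundedness of `P` makes the set in `nextCut` nonempty, so the infimum is attained. -/
lemma nextCut_spec (hub : ∀ x, ∃ t, x ≤ P t) (hP : Monotone P) (s : ℝ) (t : ℕ) :
    t ≤ nextCut P s t ∧ P t + s ≤ P (nextCut P s t) := by
  refine Nat.sInf_mem (s := {t' | t ≤ t' ∧ P t + s ≤ P t'}) ?_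
  obtain ⟨t', ht'⟩ := hub (P t + s)
  exact ⟨max t t', le_max_left _ _, ht'.trans (hP (le_max_right _ _))⟩

lemma nextCut_upper (hub : ∀ x, ∃ t, x ≤ P t) (hP : Monotone P)
    (hM : ∀ t, P (t + 1) ≤ P t + M) (hM0 : 0 ≤ M) {s : ℝ} (hs : 0 ≤ s) (t : ℕ) :
    P (nextCut P s t) ≤ P t + s + M := by
  rcases (nextCut_spec hub hP s t).1.eq_or_lt with h | h
  · rw [← h]; linarith
  · obtain ⟨x, hx⟩ : ∃ x, nextCut P s t = x + 1 := ⟨nextCut P s t - 1, by omega⟩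
    have h2 : x ∉ {t' | t ≤ t' ∧ P t + s ≤ P t'} :=
      Nat.notMem_of_lt_sInf (by rw [← nextCut, hx]; omega)
    simp only [Set.mem_ofPred_eq, not_and, not_le] at h2
    have := h2 (by omega)
    rw [hx]
    linarith [hM x]

lemma nextCut_mono (hub : ∀ x, ∃ t, x ≤ P t) (hP : Monotone P) {s s' : ℝ} (hs : s ≤ s')
    {t t' : ℕ} (ht : t ≤ t') : nextCut P s t ≤ nextCut P s' t' := by
  have h := nextCut_spec hub hP s' t'
  exact Nat.sInf_le ⟨ht.trans h.1, by linarith [hP ht, h.2]⟩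

lemma greedyCut_mono (hub : ∀ x, ∃ t, x ≤ P t) (hP : Monotone P) {s s' : ℝ} (hs : s ≤ s')
    (j : ℕ) : greedyCut P s j ≤ greedyCut P s' j := by
  induction j with
  | zero => exact le_rfl
  | succ j ih => exact nextCut_mono hub hP hs ih

lemma greedyCut_zero (j : ℕ) : greedyCut P 0 j = 0 := by
  induction j with
  | zero => rfl
  | succ j ih =>
    rw [greedyCut, ih]
    exact Nat.le_zero.1 (Nat.sInf_le ⟨le_rfl, by simp⟩)

lemma mul_le_greedyCut (hub : ∀ x, ∃ t, x ≤ P t) (hP : Monotone P) (s : ℝ) (j : ℕ) :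
    P 0 + j * s ≤ P (greedyCut P s j) := by
  induction j with
  | zero => simp [greedyCut]
  | succ j ih =>
    have := (nextCut_spec hub hP s (greedyCut P s j)).2
    rw [greedyCut]
    push_cast
    linarith

/-- Between the greedy cuts for two thresholds every index ends a block partition. -/
lemma exists_cuts_between (hub : ∀ x, ∃ t, x ≤ P t) (hP : Monotone P)
    (hM : ∀ t, P (t + 1) ≤ P t + M) (hM0 : 0 ≤ M) {s s' : ℝ} (hs : 0 ≤ s) (hss : s ≤ s')
    (j : ℕ) : ∀ t, greedyCut P s j ≤ t → t ≤ greedyCut P s' j →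
      ∃ T : ℕ → ℕ, T 0 = 0 ∧ T j = t ∧ ∀ i < j, T i ≤ T (i + 1) ∧
        P (T i) + s ≤ P (T (i + 1)) ∧ P (T (i + 1)) ≤ P (T i) + s' + M := by
  induction j with
  | zero =>
    intro t _ h
    exact ⟨fun _ => 0, rfl, (Nat.le_zero.1 h).symm, by simp⟩
  | succ j ih =>
    intro t h1 h2
    have hspec := nextCut_spec hub hP s (greedyCut P s j)
    have hs' : P (greedyCut P s' (j + 1)) ≤ P (greedyCut P s' j) + s' + M :=
      nextCut_upper hub hP hM hM0 (hs.trans hss) _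
    classical
    set q : ℕ → Prop := fun x => P x + s ≤ P t
    set L := min t (greedyCut P s' j) with hL
    have hle : greedyCut P s j ≤ L :=
      le_min (hspec.1.trans h1) (greedyCut_mono hub hP hss j)
    have hq : q (greedyCut P s j) := hspec.2.trans (hP h1)
    -- The last block starts as late as its lower bound `s` permits. If the search stopped before
    -- `L`, one more step would make the block too light, which bounds its sum; at `L` the bound is
    -- trivial or comes from the greedy cut for `s'`.
    set x := Nat.findGreatest q L with hx
    have hqx : q x := Nat.findGreatest_spec hle hq
    have hxL : x ≤ L := Nat.findGreatest_le L
    have hup : P t ≤ P x + s' + M := by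
      rcases hxL.eq_or_lt with h | h
      · rcases min_choice t (greedyCut P s' j) with h' | h'
        · rw [h, hL, h']; linarith
        · rw [h, hL, h']; linarith [hP h2]
      · have h3 : ¬ q (x + 1) := Nat.findGreatest_is_greatest (Nat.lt_succ_self x) h
        have h4 : P t < P (x + 1) + s := not_le.1 h3
        linarith [hM x]
    obtain ⟨T, hT0, hTj, hT⟩ := ih x (Nat.le_findGreatest hle hq) (hxL.trans (min_le_right _ _))
    refine ⟨fun i => if i ≤ j then T i else t, by simp [hT0], by simp, fun i hi => ?_⟩
    rcases (Nat.lt_succ_iff.1 hi).eq_or_lt with rfl | hij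
    · simp only [le_refl, if_true, Nat.not_succ_le_self, if_false, hTj]
      exact ⟨hxL.trans (min_le_left _ _), hqx, hup⟩
    · simpa [hij.le, Nat.succ_le_of_lt hij] using hT i hij

/-- A sequence with terms in `[0, M]` can be cut into `k` consecutive blocks whose sums differ by
at most `M + ε`. -/
lemma exists_block_partition (hub : ∀ x, ∃ t, x ≤ P t) (hP : Monotone P)
    (hM : ∀ t, P (t + 1) ≤ P t + M) (hM0 : 0 ≤ M) (N : ℕ) {k : ℕ} (hk : 0 < k) {ε : ℝ}
    (hε : 0 < ε) : ∃ (s : ℝ) (T : ℕ → ℕ), T 0 = 0 ∧ T k = N ∧ ∀ i < k, T i ≤ T (i + 1) ∧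
        P (T i) + s ≤ P (T (i + 1)) ∧ P (T (i + 1)) ≤ P (T i) + s + (M + ε) := by
  classical
  -- A discrete intermediate value argument: the `k`-th greedy cut is `0` for threshold `0` and
  -- passes `N` for large thresholds, so two consecutive multiples of `ε` enclose `N`.
  have hex : ∃ n : ℕ, N < greedyCut P (n * ε) k := by
    obtain ⟨n, hn⟩ := exists_nat_gt ((P N - P 0) / ε)
    refine ⟨n, ?_⟩
    by_contra! hle
    have h1 := hP hle
    have h2 := mul_le_greedyCut hub hP (n * ε) k
    rw [div_lt_iff₀ hε] at hn
    have h3 : (1 : ℝ) ≤ k := by exact_mod_cast hk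
    have h4 : (0 : ℝ) ≤ n * ε := by positivity
    nlinarith
  obtain ⟨n, hn⟩ : ∃ n, Nat.find hex = n + 1 := by
    refine Nat.exists_eq_succ_of_ne_zero fun h => ?_
    have := Nat.find_spec hex
    rw [h] at this
    simp [greedyCut_zero] at this
  have h1 : N < greedyCut P ((n + 1 : ℕ) * ε) k := hn ▸ Nat.find_spec hex
  have h2 : greedyCut P (n * ε) k ≤ N := not_lt.1 (Nat.find_min hex (by omega))
  obtain ⟨T, hT0, hTk, hT⟩ := exists_cuts_between hub hP hM hM0 (s := n * ε)
    (s' := (n + 1 : ℕ) * ε) (by positivity) (by gcongr; omega) k N h2 h1.le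
  refine ⟨n * ε, T, hT0, hTk, fun i hi => ⟨(hT i hi).1, (hT i hi).2.1, ?_⟩⟩
  have := (hT i hi).2.2
  push_cast at this
  linarith

end Blocks

/-! ### Balanced separations obtained from vertex labels. -/

section Separations

/-- Numbers that are each at most two thirds of `T`, and sum up to at most `T`, can be grouped into
two parts of sum at most two thirds of `T`. -/
lemma exists_grouping {ι : Type*} [Fintype ι] [DecidableEq ι] (f : ι → ℝ≥0) (T : ℝ≥0)
    (hf : ∀ i, f i ≤ 2 / 3 * T) (hT : ∑ i, f i ≤ T) :
    ∃ J : Finset ι, ∑ i ∈ J, f i ≤ 2 / 3 * T ∧ ∑ i ∈ Jᶜ, f i ≤ 2 / 3 * T := by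
  have hsplit : ∀ J : Finset ι, ∑ i ∈ J, f i + ∑ i ∈ Jᶜ, f i ≤ T := fun J =>
    (Finset.sum_add_sum_compl J f).trans_le hT
  have key : ∀ a b : ℝ≥0, a + b ≤ T → T / 3 ≤ a → b ≤ 2 / 3 * T := by
    intro a b h1 h2
    rw [← NNReal.coe_le_coe] at h1 h2 ⊢
    push_cast at h1 h2 ⊢
    linarith
  by_cases h : ∃ i, T / 3 ≤ f i
  · obtain ⟨i, hi⟩ := h
    exact ⟨{i}, by simpa using hf i, key _ _ (hsplit {i}) (by simpa using hi)⟩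
  · push Not at h
    -- All numbers are below `T / 3`. If the complement of a largest admissible `J` were too heavy,
    -- `J` would weigh less than `T / 3` and could take in another index.
    obtain ⟨J, hJ, hmax⟩ := Finset.exists_max_image
      (Finset.univ.filter fun J : Finset ι => ∑ i ∈ J, f i ≤ 2 / 3 * T) Finset.card
      ⟨∅, by simp⟩
    simp only [Finset.mem_filter, Finset.mem_univ, true_and] at hJ hmax
    refine ⟨J, hJ, ?_⟩
    by_contra! hlt
    have hJ3 : ∑ i ∈ J, f i < T / 3 := by
      by_contra! h3
      exact hlt.not_ge (key _ _ (hsplit J) h3)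
    obtain ⟨i, hi⟩ : Jᶜ.Nonempty := by
      rw [Finset.nonempty_iff_ne_empty]
      intro h0
      simp [h0] at hlt
    have hi' : i ∉ J := by simpa using hi
    have h1 := hmax (insert i J) (by
      rw [Finset.sum_insert hi']
      have := h i
      rw [← NNReal.coe_lt_coe] at this hJ3
      rw [← NNReal.coe_le_coe]
      push_cast at this hJ3 ⊢
      linarith)
    rw [Finset.card_insert_of_notMem hi'] at h1
    omega

variable {V : Type*}

open Classical in
/-- A set `S` separates `G[W]` in a balanced way if the remaining vertices carry labels that are
constant along edges and no label is too heavy. -/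
lemma exists_separation_of_labels {ι : Type*} [Fintype ι] (G : SimpleGraph V)
    (W S : Finset V) (hS : S ⊆ W) (w : V → ℝ≥0) (l : V → ι)
    (hl : ∀ u ∈ W \ S, ∀ v ∈ W \ S, G.Adj u v → l u = l v)
    (hw : ∀ i, total w ((W \ S).filter fun v => l v = i) ≤ 2 / 3 * total w W) :
    ∃ A B : Finset V, IsBalancedSeparation G W w A B ∧ A ∩ B = S := by
  have hsum : ∀ J : Finset ι, ∑ i ∈ J, total w ((W \ S).filter fun v => l v = i) =
      total w ((W \ S).filter fun v => l v ∈ J) := by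
    intro J
    rw [total, ← Finset.sum_fiberwise_of_maps_to (t := J) (g := l)]
    · refine Finset.sum_congr rfl fun i hi => ?_
      rw [total, Finset.filter_filter]
      refine Finset.sum_congr ?_ fun _ _ => rfl
      ext v
      simp only [Finset.mem_filter, and_congr_right_iff]
      exact fun _ => ⟨fun h => ⟨h ▸ hi, h⟩, fun h => h.2⟩
    · intro v hv
      exact (Finset.mem_filter.1 hv).2
  obtain ⟨J, h1, h2⟩ := exists_grouping _ (total w W) hw (by
    rw [hsum]
    exact Finset.sum_le_sum_of_subset fun v hv => by
      simp only [Finset.mem_filter, Finset.mem_sdiff] at hv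
      exact hv.1.1)
  rw [hsum] at h1 h2
  refine ⟨S ∪ (W \ S).filter (fun v => l v ∈ J), S ∪ (W \ S).filter (fun v => l v ∈ Jᶜ), ?_, ?_⟩
  · have hA : (S ∪ (W \ S).filter (fun v => l v ∈ J)) \ (S ∪ (W \ S).filter (fun v => l v ∈ Jᶜ)) =
        (W \ S).filter (fun v => l v ∈ J) := by
      ext v
      simp only [Finset.mem_sdiff, Finset.mem_union, Finset.mem_filter, Finset.mem_compl]
      tauto
    have hB : (S ∪ (W \ S).filter (fun v => l v ∈ Jᶜ)) \ (S ∪ (W \ S).filter (fun v => l v ∈ J)) =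
        (W \ S).filter (fun v => l v ∈ Jᶜ) := by
      ext v
      simp only [Finset.mem_sdiff, Finset.mem_union, Finset.mem_filter, Finset.mem_compl]
      tauto
    refine ⟨?_, ?_, ?_, ?_⟩
    · ext v
      simp only [Finset.mem_sdiff, Finset.mem_union, Finset.mem_filter, Finset.mem_compl]
      have := @hS v
      tauto
    · rw [hA, hB]
      intro a ha b hb hab
      rw [Finset.mem_filter] at ha hb
      rw [← hl a ha.1 b hb.1 hab, Finset.mem_compl] at hb
      exact hb.2 ha.2
    · rwa [hA]
    · rwa [hB]
  · ext v
    simp only [Finset.mem_sdiff, Finset.mem_union, Finset.mem_filter, Finset.mem_compl,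
      Finset.mem_inter]
    tauto

variable [Fintype V]

/-- The infimum is attained because there are finitely many separations and `(W, W)` is always one.
Since `β` is finite, the product form also covers a vanishing norm. -/
lemma separability_le_iff (p : ℝ) (G : SimpleGraph V) (τ : V → ℝ≥0) (β : ℝ≥0) :
    separability p G τ ≤ β ↔ ∀ (W : Finset V) (w : V → ℝ≥0), ∃ A B,
      IsBalancedSeparation G W w A B ∧ separationCost τ A B ≤ β * pNorm p τ W := by
  have hdiv : ∀ x y : ℝ≥0, (x : ℝ≥0∞) / y ≤ β ↔ x ≤ β * y := by
    intro x y
    rw [ENNReal.div_le_iff_le_mul (Or.inr ENNReal.coe_ne_top) (Or.inl ENNReal.coe_ne_top)]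
    exact_mod_cast Iff.rfl
  simp only [separability, iSup_le_iff]
  refine forall_congr' fun W => forall_congr' fun w => ⟨fun h => ?_, ?_⟩
  · classical
    obtain ⟨⟨A, B⟩, hAB, hmin⟩ := Finset.exists_min_image
      (Finset.univ.filter fun x : Finset V × Finset V => IsBalancedSeparation G W w x.1 x.2)
      (fun x => (separationCost τ x.1 x.2 : ℝ≥0∞) / (pNorm p τ W : ℝ≥0∞))
      ⟨(W, W), Finset.mem_filter.2 ⟨Finset.mem_univ _, by simp, by simp, by simp [total], by simp [total]⟩⟩
    simp only [Finset.mem_filter, Finset.mem_univ, true_and, Prod.forall] at hAB hmin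
    exact ⟨A, B, hAB, (hdiv _ _).1 ((le_iInf fun A' => le_iInf fun B' => le_iInf fun h' =>
      hmin A' B' h').trans h)⟩
  · rintro ⟨A, B, hAB, h⟩
    exact iInf_le_of_le A (iInf_le_of_le B (iInf_le_of_le hAB ((hdiv _ _).2 h)))

open Classical in
/-- A labelling all of whose classes have at most half of the weight cuts edges of total cost
proportional to that of a balanced separation. -/
lemma separation_le_cut_of_labels {ι : Type*} [Fintype ι] (G : SimpleGraph V)
    (c : Sym2 V → ℝ≥0) {Δ : ℕ} {φ : ℝ≥0} (h : WellBehaved G c Δ φ) (w : V → ℝ≥0) (x : ℝ≥0)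
    (hx : ∀ A B : Finset V, IsBalancedSeparation G Finset.univ w A B →
      x ≤ separationCost (vertexCost G c) A B) (l : V → ι)
    (hw : ∀ i, total w (Finset.univ.filter fun v => l v = i) ≤ 2 / 3 * total w Finset.univ) :
    x ≤ φ * ∑ u, ∑ v, if l u = l v then 0 else pairCost G c u v := by
  obtain ⟨A, B, hAB, hS⟩ := exists_separation_of_labels G Finset.univ
    -- The separator consists of the vertices with a neighbour of another label; each is paid for by
    -- one such edge, as `τ(u) ≤ φ c(uv)`.
    (Finset.univ.filter fun u => ∃ v, G.Adj u v ∧ l u ≠ l v) (Finset.subset_univ _) w l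
    (by
      intro u hu v _ huv
      by_contra hne
      simp only [Finset.mem_sdiff, Finset.mem_filter, Finset.mem_univ, true_and] at hu
      exact hu ⟨v, huv, hne⟩)
    (fun i => le_trans (Finset.sum_le_sum_of_subset
      (Finset.filter_subset_filter _ (Finset.subset_univ _))) (hw i))
  refine (hx A B hAB).trans ?_
  rw [separationCost, hS, total, Finset.mul_sum]
  refine (Finset.sum_le_sum fun u hu => ?_).trans
    (Finset.sum_le_sum_of_subset (Finset.subset_univ _))
  obtain ⟨v, huv, hne⟩ := (Finset.mem_filter.1 hu).2
  refine (vertexCost_le_mul G c h huv).trans (mul_le_mul_right ?_ _)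
  have := Finset.single_le_sum (f := fun v => if l u = l v then 0 else pairCost G c u v)
    (fun _ _ => zero_le) (Finset.mem_univ v)
  simpa [hne] using this

open Classical in
-- A bichromatic edge contributes to the boundaries of two classes, matching its two orientations on
-- the right.
lemma sum_boundaryCost_colorClass (G : SimpleGraph V) (c : Sym2 V → ℝ≥0) {k : ℕ}
    (χ : V → Fin k) : ∑ i, boundaryCost G c (colorClass χ i) =
      ∑ u, ∑ v, if χ u = χ v then 0 else pairCost G c u v := by
  rw [← Finset.sum_fiberwise (s := Finset.univ) (g := χ)]
  refine Finset.sum_congr rfl fun i _ => ?_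
  rw [boundaryCost_eq_sum]
  refine Finset.sum_congr rfl fun u hu => ?_
  have hu' : χ u = i := (Finset.mem_filter.1 hu).2
  subst hu'
  simp only [← ite_not (p := χ u = χ _)]
  rw [← Finset.sum_filter]
  refine Finset.sum_congr ?_ fun _ _ => rfl
  ext v
  simp [colorClass, eq_comm]

end Separations

/-! ### Disjoint copies inherit good behaviour and separability. -/

section CopiesLemmas

variable {V : Type*} (m : ℕ) (G : SimpleGraph V) (c : Sym2 V → ℝ≥0)

lemma pairCost_copies (x y : Fin m × V) :
    pairCost (copies m G) (copiesCost m c) x y =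
      if x.1 = y.1 then pairCost G c x.2 y.2 else 0 := by
  simp only [pairCost, copies, copiesCost, Sym2.map_mk]
  by_cases h1 : x.1 = y.1 <;> by_cases h2 : G.Adj x.2 y.2 <;> simp [h1, h2]

variable [Fintype V]

lemma vertexCost_copies (x : Fin m × V) :
    vertexCost (copies m G) (copiesCost m c) x = vertexCost G c x.2 := by
  rw [vertexCost_eq_sum, vertexCost_eq_sum, Fintype.sum_prod_type]
  simp only [pairCost_copies]
  rw [Finset.sum_eq_single x.1 (fun i _ hi => by simp [hi.symm]) (by simp)]
  simp

lemma total_copiesWeight (w : V → ℝ≥0) :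
    total (copiesWeight m w) Finset.univ = m * total w Finset.univ := by
  simp [total, copiesWeight, Fintype.sum_prod_type]

lemma wellBehaved_copies {Δ : ℕ} {φ : ℝ≥0} (h : WellBehaved G c Δ φ) :
    WellBehaved (copies m G) (copiesCost m c) Δ φ := by
  classical
  constructor
  · refine SimpleGraph.maxDegree_le_of_forall_degree_le _ _ fun x => ?_
    refine le_trans ?_ ((G.degree_le_maxDegree x.2).trans h.1)
    rw [← SimpleGraph.card_neighborFinset_eq_degree, ← SimpleGraph.card_neighborFinset_eq_degree]
    refine Finset.card_le_card_of_injOn Prod.snd ?_ ?_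
    · intro y hy
      simp only [Finset.mem_coe, SimpleGraph.mem_neighborFinset] at hy ⊢
      exact hy.2
    · intro y hy z hz hyz
      simp only [Finset.mem_coe, SimpleGraph.mem_neighborFinset] at hy hz
      exact Prod.ext (hy.1.symm.trans hz.1) hyz
  · refine iSup₂_le fun e he => iSup₂_le fun x hx => ?_
    obtain ⟨y, rfl⟩ := hx
    have hadj : (copies m G).Adj x y := by simpa [edges] using he
    have h1 := vertexCost_le_mul G c h hadj.2
    rw [ENNReal.div_le_iff_le_mul (Or.inr ENNReal.coe_ne_top) (Or.inl ENNReal.coe_ne_top),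
      vertexCost_copies]
    rw [pairCost, if_pos hadj.2] at h1
    exact_mod_cast h1

open Classical in
-- The constant does not grow. If no copy holds more than two thirds of the weight, whole copies can
-- be grouped with an empty separator. Otherwise it suffices to separate the heavy copy, as all
-- others together weigh less than a third.
lemma separability_copies {p : ℝ} (hp : 0 < p) {β : ℝ≥0}
    (h : separability p G (vertexCost G c) ≤ β) :
    separability p (copies m G) (vertexCost (copies m G) (copiesCost m c)) ≤ β := by
  rw [separability_le_iff] at h ⊢
  intro W w
  set fib : Fin m → Finset (Fin m × V) := fun i => W.filter fun x => x.1 = i with hfib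
  by_cases hlight : ∀ i, total w (fib i) ≤ 2 / 3 * total w W
  · obtain ⟨A, B, hAB, hS⟩ := exists_separation_of_labels (copies m G) W ∅ (by simp) w Prod.fst
      (fun u _ v _ huv => huv.1) (fun i => by
        refine le_trans (Finset.sum_le_sum_of_subset fun x hx => ?_) (hlight i)
        simpa [hfib] using hx)
    refine ⟨A, B, hAB, ?_⟩
    rw [separationCost, hS]
    simp [total]
  · push Not at hlight
    obtain ⟨i, hi⟩ := hlight
    set Wi : Finset V := Finset.univ.filter fun v => (i, v) ∈ W with hWi
    obtain ⟨A, B, hAB, hcost⟩ := h Wi fun v => w (i, v)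
    obtain ⟨hU, hadj, hA, hB⟩ := hAB
    have hemb : ∀ (f : Fin m × V → ℝ≥0) (X : Finset V),
        total f (X.map ⟨fun v => (i, v), Prod.mk_right_injective i⟩) =
        total (fun v => f (i, v)) X := fun f X => by simp [total]
    have hfibi : fib i = Wi.map ⟨fun v => (i, v), Prod.mk_right_injective i⟩ := by
      ext ⟨j, v⟩
      simp only [hfib, hWi, Finset.mem_filter, Finset.mem_map, Finset.mem_univ, true_and,
        Function.Embedding.coeFn_mk, Prod.mk.injEq]
      constructor
      · rintro ⟨h1, rfl⟩
        exact ⟨v, h1, rfl, rfl⟩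
      · rintro ⟨v, h1, rfl, rfl⟩
        exact ⟨h1, rfl⟩
    have hfibW : fib i ⊆ W := Finset.filter_subset _ _
    have hle : total (fun v => w (i, v)) Wi ≤ total w W := by
      rw [← hemb, ← hfibi]
      exact Finset.sum_le_sum_of_subset hfibW
    set S := (A ∩ B).map ⟨fun v => (i, v), Prod.mk_right_injective i⟩ with hSdef
    have hmemS : ∀ j v, (j, v) ∈ S ↔ j = i ∧ v ∈ A ∧ v ∈ B := by
      intro j v
      simp only [hSdef, Finset.mem_map, Finset.mem_inter, Function.Embedding.coeFn_mk,
        Prod.mk.injEq]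
      constructor
      · rintro ⟨v, h1, rfl, rfl⟩
        exact ⟨rfl, h1⟩
      · rintro ⟨rfl, h1⟩
        exact ⟨v, h1, rfl, rfl⟩
    have hmemU : ∀ v, (i, v) ∈ W ↔ v ∈ A ∨ v ∈ B := by
      intro v
      rw [← Finset.mem_union, hU]
      simp [hWi]
    obtain ⟨A', B', hAB', hS⟩ := exists_separation_of_labels (copies m G) W S
      (by
        rintro ⟨j, v⟩ hv
        obtain ⟨rfl, hvA, -⟩ := (hmemS j v).1 hv
        exact (hmemU v).2 (Or.inl hvA))
      -- Three labels: the two sides of the heavy copy, and `none` for all the other copies.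
      w (fun x => if x.1 = i then some (decide (x.2 ∈ A)) else none)
      (by
        rintro ⟨j, u⟩ hu ⟨j', v⟩ hv ⟨hjj, huv⟩
        obtain rfl : j = j' := hjj
        by_cases hj : j = i
        · subst hj
          simp only [Finset.mem_sdiff, hmemS, hmemU, true_and] at hu hv
          simp only [if_true]
          congr 1
          rw [decide_eq_decide]
          have h1 := hadj u
          have h2 := hadj v
          simp only [Finset.mem_sdiff] at h1 h2
          constructor
          · intro hA
            by_contra hA'
            exact h1 (by tauto) v (by tauto) huv
          · intro hA
            by_contra hA'
            exact h2 (by tauto) u (by tauto) huv.symm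
        · simp [hj])
      (by
        have hthird : ∀ X : Finset (Fin m × V), ∀ Y : Finset V,
            X ⊆ Y.map ⟨fun v => (i, v), Prod.mk_right_injective i⟩ →
            total (fun v => w (i, v)) Y ≤ 2 / 3 * total (fun v => w (i, v)) Wi →
            total w X ≤ 2 / 3 * total w W := by
          intro X Y hXY hY
          calc total w X ≤ total w (Y.map ⟨fun v => (i, v), Prod.mk_right_injective i⟩) :=
                Finset.sum_le_sum_of_subset hXY
            _ = total (fun v => w (i, v)) Y := hemb _ _
            _ ≤ 2 / 3 * total (fun v => w (i, v)) Wi := hY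
            _ ≤ 2 / 3 * total w W := mul_le_mul_right hle _
        rintro (_ | _ | _)
        · refine le_trans (b := total w (W \ fib i)) (Finset.sum_le_sum_of_subset ?_) ?_
          · rintro ⟨j, v⟩ hv
            simp only [Finset.mem_filter, Finset.mem_sdiff, hfib] at hv ⊢
            refine ⟨hv.1.1, fun hj => ?_⟩
            simp [hj.2] at hv
          have h1 : total w (W \ fib i) + total w (fib i) = total w W :=
            Finset.sum_sdiff hfibW
          rw [← NNReal.coe_le_coe]
          rw [← NNReal.coe_lt_coe] at hi
          rw [← NNReal.coe_inj] at h1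
          push_cast at hi h1 ⊢
          have := (total w W).coe_nonneg
          linarith
        · refine hthird _ (B \ A) ?_ hB
          rintro ⟨j, v⟩ hv
          simp only [Finset.mem_filter, Finset.mem_sdiff] at hv
          by_cases hj : j = i
          · subst hj
            simp only [hmemU, if_true, Option.some.injEq, decide_eq_false_iff_not] at hv
            simp only [Finset.mem_map, Finset.mem_sdiff, Function.Embedding.coeFn_mk]
            exact ⟨v, by tauto, rfl⟩
          · simp [hj] at hv
        · refine hthird _ (A \ B) ?_ hA
          rintro ⟨j, v⟩ hv
          simp only [Finset.mem_filter, Finset.mem_sdiff] at hv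
          by_cases hj : j = i
          · subst hj
            simp only [hmemU, hmemS, if_true, Option.some.injEq, decide_eq_true_eq] at hv
            simp only [Finset.mem_map, Finset.mem_sdiff, Function.Embedding.coeFn_mk]
            exact ⟨v, by tauto, rfl⟩
          · simp [hj] at hv)
    refine ⟨A', B', hAB', ?_⟩
    rw [separationCost, hS, hSdef, hemb]
    simp only [vertexCost_copies]
    refine hcost.trans (mul_le_mul_right ?_ _)
    refine NNReal.rpow_le_rpow ?_ (by positivity)
    have h1 := hemb (fun x => vertexCost (copies m G) (copiesCost m c) x ^ p) Wi
    rw [← hfibi] at h1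
    simp only [vertexCost_copies, total] at h1
    simp only [vertexCost_copies]
    rw [← h1]
    exact Finset.sum_le_sum_of_subset hfibW

end CopiesLemmas

/-! ### Linear layouts whose cuts are all cheap. -/

section Layouts

variable {V : Type*} [Fintype V]

open Classical in
/-- The cost of the edges of `G[W]` between the vertices of rank less than `t` and the others. -/
noncomputable def layoutCut (G : SimpleGraph V) (c : Sym2 V → ℝ≥0) (W : Finset V) (r : V → ℕ)
    (t : ℕ) : ℝ≥0 :=
  ∑ u, ∑ v, if u ∈ W ∧ v ∈ W ∧ r u < t ∧ t ≤ r v then pairCost G c u v else 0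

open Classical in
lemma layoutCut_le_total (G : SimpleGraph V) (c : Sym2 V → ℝ≥0) (W : Finset V) (r : V → ℕ)
    (t : ℕ) : layoutCut G c W r t ≤ total (vertexCost G c) W := by
  rw [layoutCut, total, ← Finset.sum_filter_add_sum_filter_not Finset.univ (· ∈ W)]
  rw [Finset.filter_univ_mem]
  have h0 : ∑ u ∈ Finset.univ.filter (¬ · ∈ W), ∑ v,
      (if u ∈ W ∧ v ∈ W ∧ r u < t ∧ t ≤ r v then pairCost G c u v else 0) = 0 :=
    Finset.sum_eq_zero fun u hu => Finset.sum_eq_zero fun v _ =>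
      if_neg fun h => (Finset.mem_filter.1 hu).2 h.1
  rw [h0, add_zero]
  refine Finset.sum_le_sum fun u _ => ?_
  rw [vertexCost_eq_sum]
  refine Finset.sum_le_sum fun v _ => ?_
  split_ifs
  · exact le_rfl
  · exact zero_le

open Classical in
-- The recursion step for layouts: edges with an end in the separator `S` are paid for by `τ(S)`,
-- once for each possible position of that end, and the remaining ones cross a cut of the smaller
-- part `Z`.
lemma layoutCut_le_add (G : SimpleGraph V) (c : Sym2 V → ℝ≥0) {W S Z : Finset V} {r r' : V → ℕ}
    {t t' : ℕ} (h : ∀ u ∈ W, ∀ v ∈ W, u ∉ S → v ∉ S → G.Adj u v → r u < t → t ≤ r v →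
      u ∈ Z ∧ v ∈ Z ∧ r' u < t' ∧ t' ≤ r' v) :
    layoutCut G c W r t ≤ 2 * total (vertexCost G c) S + layoutCut G c Z r' t' := by
  have h1 : total (vertexCost G c) S = ∑ u, ∑ v, if u ∈ S then pairCost G c u v else 0 := by
    simp only [Finset.sum_ite_irrel, Finset.sum_const_zero, ← vertexCost_eq_sum, total,
      Finset.sum_ite_mem, Finset.univ_inter]
  have h2 : total (vertexCost G c) S = ∑ u, ∑ v, if v ∈ S then pairCost G c u v else 0 := by
    rw [h1, Finset.sum_comm]
    refine Finset.sum_congr rfl fun u _ => Finset.sum_congr rfl fun v _ => ?_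
    rw [pairCost_comm]
  rw [two_mul]
  nth_rewrite 2 [h2]
  rw [h1]
  simp only [layoutCut, ← Finset.sum_add_distrib]
  refine Finset.sum_le_sum fun u _ => Finset.sum_le_sum fun v _ => ?_
  split_ifs with hc hu hv hz hz hv hz hz <;>
    first
    | exact zero_le
    | simp only [le_add_iff_nonneg_left, le_add_iff_nonneg_right, add_zero, zero_add, zero_le,
        le_refl, add_assoc]
  have hadj : ¬ G.Adj u v := fun hadj => hz (h u hc.1 v hc.2.1 hu hv hadj hc.2.2.1 hc.2.2.2)
  simp [pairCost, hadj]

open Classical in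
/-- If every induced subgraph has cheap balanced separations, the vertices can be laid out on a
line such that every cut of the layout is cheap. -/
lemma exists_layout (G : SimpleGraph V) (c : Sym2 V → ℝ≥0) {p : ℝ} (hp : 0 < p) {β C : ℝ≥0}
    (h : separability p G (vertexCost G c) ≤ β) (hC : 2 * β + (2 / 3) ^ (1 / p) * C ≤ C) :
    ∀ (n : ℕ) (W : Finset V), W.card = n → ∃ (N : ℕ) (r : V → ℕ), (∀ v ∈ W, r v < N) ∧
      Set.InjOn r W ∧ ∀ t, layoutCut G c W r t ≤ C * pNorm p (vertexCost G c) W := by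
  intro n
  induction n using Nat.strong_induction_on with
  | _ n ih =>
  intro W hW
  set τ := vertexCost G c with hτ
  set e : V → ℕ := fun v => (Fintype.equivFin V v : ℕ) with he
  have he_inj : Function.Injective e := fun u v huv =>
    (Fintype.equivFin V).injective (Fin.ext huv)
  have he_lt : ∀ v, e v < Fintype.card V := fun v => (Fintype.equivFin V v).2
  -- Base case. Only for positive total weight does balance force both sides to have fewer vertices
  -- than `W`.
  by_cases h0 : total (fun v => τ v ^ p) W = 0
  · refine ⟨_, e, fun v _ => he_lt v, he_inj.injOn, fun t => ?_⟩
    have h1 : total τ W = 0 := by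
      rw [total, Finset.sum_eq_zero_iff] at h0 ⊢
      intro v hv
      exact (NNReal.rpow_eq_zero hp.ne').1 (h0 v hv)
    exact ((layoutCut_le_total G c W e t).trans h1.le).trans zero_le
  -- With the weights `τ^p`, balance shrinks the `p`-norm by the factor `(2/3)^(1/p)`, which makes
  -- the costs geometric.
  obtain ⟨A, B, ⟨hU, hadj, hA, hB⟩, hcost⟩ := (separability_le_iff _ _ _ _).1 h W fun v => τ v ^ p
  have hcard : ∀ X ⊆ W, total (fun v => τ v ^ p) X ≤ 2 / 3 * total (fun v => τ v ^ p) W →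
      X.card < n := by
    intro X hX hle
    rw [← hW]
    refine Finset.card_lt_card (hX.ssubset_of_ne ?_)
    rintro rfl
    have h1 : 0 < total (fun v => τ v ^ p) X := pos_iff_ne_zero.2 h0
    rw [← NNReal.coe_le_coe] at hle
    rw [← NNReal.coe_pos] at h1
    push_cast at hle
    linarith
  have hnorm : ∀ X : Finset V, total (fun v => τ v ^ p) X ≤ 2 / 3 * total (fun v => τ v ^ p) W →
      pNorm p τ X ≤ (2 / 3) ^ (1 / p) * pNorm p τ W := by
    intro X hle
    rw [pNorm, pNorm, ← NNReal.mul_rpow]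
    exact NNReal.rpow_le_rpow hle (by positivity)
  have hAW : A \ B ⊆ W := fun v hv => hU ▸ Finset.mem_union_left _ (Finset.mem_sdiff.1 hv).1
  have hBW : B \ A ⊆ W := fun v hv => hU ▸ Finset.mem_union_right _ (Finset.mem_sdiff.1 hv).1
  obtain ⟨N₁, r₁, hr₁, hinj₁, hcut₁⟩ := ih _ (hcard _ hAW hA) (A \ B) rfl
  obtain ⟨N₂, r₂, hr₂, hinj₂, hcut₂⟩ := ih _ (hcard _ hBW hB) (B \ A) rfl
  set K := N₁ + Fintype.card V with hK
  -- The order on the line is `A \ B`, then `A ∩ B`, then `B \ A` from `K` onwards. An edge avoiding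
  -- the separator stays on one side, so a cut at `t ≤ K` splits only such edges in `A \ B`, and one
  -- at `t ≥ K` only those in `B \ A`.
  set r : V → ℕ := fun v => if v ∈ A \ B then r₁ v else if v ∈ B \ A then K + r₂ v else N₁ + e v
    with hr
  have hrX : ∀ v ∈ A \ B, r v = r₁ v := fun v hv => if_pos hv
  have hrY : ∀ v ∈ B \ A, r v = K + r₂ v := by
    intro v hv
    have : v ∉ A \ B := fun hv' => (Finset.mem_sdiff.1 hv').2 (Finset.mem_sdiff.1 hv).1
    simp only [hr, if_neg this, if_pos hv]
  have hrS : ∀ v ∈ A ∩ B, r v = N₁ + e v := by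
    intro v hv
    rw [Finset.mem_inter] at hv
    have h1 : v ∉ A \ B := fun hv' => (Finset.mem_sdiff.1 hv').2 hv.2
    have h2 : v ∉ B \ A := fun hv' => (Finset.mem_sdiff.1 hv').2 hv.1
    simp only [hr, if_neg h1, if_neg h2]
  have hcases : ∀ v ∈ W, v ∈ A \ B ∨ v ∈ B \ A ∨ v ∈ A ∩ B := by
    intro v hv
    rw [← hU, Finset.mem_union] at hv
    simp only [Finset.mem_sdiff, Finset.mem_inter]
    tauto
  have hfin : ∀ (Z : Finset V) (r' : V → ℕ) (t t' : ℕ),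
      layoutCut G c Z r' t' ≤ C * pNorm p τ Z →
      total (fun v => τ v ^ p) Z ≤ 2 / 3 * total (fun v => τ v ^ p) W →
      (∀ u ∈ W, ∀ v ∈ W, u ∉ A ∩ B → v ∉ A ∩ B → G.Adj u v → r u < t → t ≤ r v →
        u ∈ Z ∧ v ∈ Z ∧ r' u < t' ∧ t' ≤ r' v) →
      layoutCut G c W r t ≤ C * pNorm p τ W := by
    intro Z r' t t' h1 h2 h3
    calc layoutCut G c W r t ≤ 2 * total τ (A ∩ B) + layoutCut G c Z r' t' :=
          layoutCut_le_add G c h3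
      _ ≤ 2 * (β * pNorm p τ W) + C * ((2 / 3) ^ (1 / p) * pNorm p τ W) := by
          refine add_le_add (mul_le_mul_right hcost _) (h1.trans ?_)
          exact mul_le_mul_right (hnorm Z h2) _
      _ = (2 * β + (2 / 3) ^ (1 / p) * C) * pNorm p τ W := by ring
      _ ≤ C * pNorm p τ W := by gcongr
  refine ⟨K + N₂, r, ?_, ?_, ?_⟩
  · intro v hv
    rcases hcases v hv with h1 | h1 | h1
    · rw [hrX v h1]; have := hr₁ v h1; omega
    · rw [hrY v h1]; have := hr₂ v h1; omega
    · rw [hrS v h1]; have := he_lt v; omega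
  · intro u hu v hv huv
    have eu := he_lt u
    have ev := he_lt v
    rcases hcases u hu with h1 | h1 | h1 <;> rcases hcases v hv with h2 | h2 | h2
    · rw [hrX u h1, hrX v h2] at huv; exact hinj₁ h1 h2 huv
    · rw [hrX u h1, hrY v h2] at huv; have := hr₁ u h1; omega
    · rw [hrX u h1, hrS v h2] at huv; have := hr₁ u h1; omega
    · rw [hrY u h1, hrX v h2] at huv; have := hr₁ v h2; omega
    · rw [hrY u h1, hrY v h2] at huv; exact hinj₂ h1 h2 (by omega)
    · rw [hrY u h1, hrS v h2] at huv; omega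
    · rw [hrS u h1, hrX v h2] at huv; have := hr₁ v h2; omega
    · rw [hrS u h1, hrY v h2] at huv; omega
    · rw [hrS u h1, hrS v h2] at huv; exact he_inj (by omega)
  · intro t
    rcases le_total t K with ht | ht
    · refine hfin (A \ B) r₁ t t (hcut₁ t) hA fun u hu v hv hu' hv' huv h1 h2 => ?_
      have hu1 : u ∈ A \ B := by
        rcases hcases u hu with h | h | h
        · exact h
        · rw [hrY u h] at h1; omega
        · exact absurd h hu'
      have hv1 : v ∈ A \ B := by
        rcases hcases v hv with h | h | h
        · exact h
        · exact absurd huv (hadj u hu1 v h)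
        · exact absurd h hv'
      exact ⟨hu1, hv1, hrX u hu1 ▸ h1, hrX v hv1 ▸ h2⟩
    · refine hfin (B \ A) r₂ t (t - K) (hcut₂ _) hB fun u hu v hv hu' hv' huv h1 h2 => ?_
      have hv1 : v ∈ B \ A := by
        rcases hcases v hv with h | h | h
        · rw [hrX v h] at h2
          have := hr₁ v h
          omega
        · exact h
        · exact absurd h hv'
      have hu1 : u ∈ B \ A := by
        rcases hcases u hu with h | h | h
        · exact absurd huv (hadj u h v hv1)
        · exact h
        · exact absurd h hu'
      rw [hrY u hu1] at h1
      rw [hrY v hv1] at h2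
      exact ⟨hu1, hv1, by omega, by omega⟩

lemma layoutCut_copies_le (m : ℕ) (G : SimpleGraph V) (c : Sym2 V → ℝ≥0) {N : ℕ} {r : V → ℕ}
    (hr : ∀ v, r v < N) {K : ℝ≥0} (hK : ∀ t, layoutCut G c Finset.univ r t ≤ K) (t : ℕ) :
    layoutCut (copies m G) (copiesCost m c) Finset.univ (fun x => x.1 * N + r x.2) t ≤ K := by
  classical
  -- Copy `i` occupies the ranks from `i * N` to below `(i + 1) * N`, so a cut at `t` can only split
  -- copy `t / N`.
  have hidx : ∀ (i : Fin m) (u v : V), i * N + r u < t → t ≤ i * N + r v → (i : ℕ) = t / N := by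
    intro i u v h1 h2
    have := hr v
    symm
    rw [Nat.div_eq_iff (by omega)]
    omega
  refine le_trans ?_ (hK (t - t / N * N))
  rw [layoutCut, Fintype.sum_prod_type]
  by_cases hm : t / N < m
  · rw [Finset.sum_eq_single ⟨t / N, hm⟩ ?_ (by simp)]
    · refine Finset.sum_le_sum fun u _ => ?_
      rw [Fintype.sum_prod_type, Finset.sum_eq_single ⟨t / N, hm⟩ ?_ (by simp)]
      · refine Finset.sum_le_sum fun v _ => ?_
        simp only [pairCost_copies, Finset.mem_univ, true_and, if_true]
        by_cases h : t / N * N + r u < t ∧ t ≤ t / N * N + r v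
        · rw [if_pos h, if_pos (by omega)]
        · rw [if_neg h]; exact zero_le
      · intro j _ hj
        exact Finset.sum_eq_zero fun v _ => by simp [pairCost_copies, hj.symm]
    · intro i _ hi
      refine Finset.sum_eq_zero fun u _ => Finset.sum_eq_zero fun y _ => ?_
      rw [pairCost_copies]
      split_ifs with h1 h2
      · have h1' := h1.2.2
        simp only [← show i = y.1 from h2] at h1'
        exact absurd (Fin.ext (hidx i u y.2 h1'.1 h1'.2)) hi
      · rfl
      · rfl
  · refine le_of_eq_of_le (Finset.sum_eq_zero fun i _ => Finset.sum_eq_zero fun u _ =>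
      Finset.sum_eq_zero fun y _ => ?_) zero_le
    rw [pairCost_copies]
    split_ifs with h1 h2
    · have h1' := h1.2.2
      simp only [← show i = y.1 from h2] at h1'
      exact absurd (hidx i u y.2 h1'.1 h1'.2 ▸ i.2) hm
    · rfl
    · rfl

end Layouts

/-! ### From layouts to strictly balanced colorings by intervals. -/

section Intervals

variable {V : Type*} [Fintype V]

/-- Numbers that pairwise differ by at most `D` differ by at most `(1 - 1/k) D` from their
average. -/
lemma abs_sub_avg_le {k : ℕ} (x : Fin k → ℝ) (D : ℝ) (h : ∀ i j, x i - x j ≤ D) (i : Fin k) :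
    |x i - (∑ j, x j) / k| ≤ (1 - 1 / (k : ℝ)) * D := by
  have hk : (0 : ℝ) < k := by exact_mod_cast i.pos
  -- The deviation is an average of `k` differences of which the one with `j = i` vanishes; hence
  -- the factor `1 - 1/k`.
  have h1 : x i - (∑ j, x j) / k = (∑ j ∈ Finset.univ.erase i, (x i - x j)) / k := by
    rw [← Finset.sum_erase_add _ _ (Finset.mem_univ i), Finset.sum_sub_distrib, Finset.sum_const,
      Finset.card_erase_of_mem (Finset.mem_univ i), Finset.card_univ, Fintype.card_fin,
      nsmul_eq_mul, Nat.cast_sub i.pos]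
    field_simp
    push_cast
    ring
  rw [h1, abs_div, abs_of_pos hk, div_le_iff₀ hk]
  refine (Finset.abs_sum_le_sum_abs _ _).trans ?_
  refine (Finset.sum_le_card_nsmul _ _ D fun j _ => abs_le.2 ⟨?_, h i j⟩).trans_eq ?_
  · linarith [h j i]
  · rw [Finset.card_erase_of_mem (Finset.mem_univ i), Finset.card_univ, Fintype.card_fin,
      nsmul_eq_mul, Nat.cast_sub i.pos]
    field_simp
    push_cast
    ring

lemma exists_block_of_lt {T : ℕ → ℕ} {k N : ℕ} (h0 : T 0 = 0) (hk : T k = N) {x : ℕ} (hx : x < N) :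
    ∃ j : Fin k, T j ≤ x ∧ x < T (j + 1) := by
  classical
  have hex : ∃ j, x < T j := ⟨k, hk ▸ hx⟩
  obtain ⟨j, hj⟩ : ∃ j, Nat.find hex = j + 1 := by
    refine Nat.exists_eq_succ_of_ne_zero fun h => ?_
    have := Nat.find_spec hex
    rw [h, h0] at this
    omega
  have h1 : Nat.find hex ≤ k := Nat.find_min' hex (hk ▸ hx)
  exact ⟨⟨j, by omega⟩, not_lt.1 (Nat.find_min hex (m := j) (by omega)), hj ▸ Nat.find_spec hex⟩

lemma block_unique {T : ℕ → ℕ} {k : ℕ} (hT : ∀ i < k, T i ≤ T (i + 1)) {x : ℕ} {i j : Fin k}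
    (hi : T i ≤ x) (hi' : x < T (i + 1)) (hj : T j ≤ x) (hj' : x < T (j + 1)) : i = j := by
  have hmono : ∀ a b, a ≤ b → b ≤ k → T a ≤ T b := by
    intro a b hab
    induction b, hab using Nat.le_induction with
    | base => exact fun _ => le_rfl
    | succ b _ ih => exact fun hb => (ih (by omega)).trans (hT b hb)
  have hi2 := i.2
  have hj2 := j.2
  rcases lt_trichotomy (i : ℕ) j with h | h | h
  · have := hmono (i + 1) j h hj2.le; omega
  · exact Fin.ext h
  · have := hmono (j + 1) i h hi2.le; omega

open Classical in
-- Classes are consecutive blocks of the layout. The slack `ε` comes from the discretised block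
-- partition and is removed afterwards.
lemma exists_coloring_of_layout (G : SimpleGraph V) (c : Sym2 V → ℝ≥0) (w : V → ℝ≥0) {N : ℕ}
    {r : V → ℕ} (hr : ∀ v, r v < N) (hinj : Function.Injective r) {K : ℝ≥0}
    (hK : ∀ t, layoutCut G c Finset.univ r t ≤ K) {k : ℕ} (hk : 0 < k) {ε : ℝ} (hε : 0 < ε) :
    ∃ χ : V → Fin k, maxBoundaryCost G c χ ≤ 2 * K ∧
      ∀ i, |(total w (colorClass χ i) : ℝ) - (total w Finset.univ : ℝ) / k|
        ≤ (1 - 1 / (k : ℝ)) * ((maxNorm w Finset.univ : ℝ) + 2 * ε) := by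
  set M : ℝ := ((maxNorm w Finset.univ : ℝ≥0) : ℝ) with hM
  have hM0 : 0 ≤ M := NNReal.coe_nonneg _
  have hwM : ∀ v, (w v : ℝ) ≤ M := fun v =>
    NNReal.coe_le_coe.2 (Finset.le_sup (f := w) (Finset.mem_univ v))
  set Q : ℕ → ℝ := fun t => ∑ v with r v < t, (w v : ℝ) with hQ
  have hQmono : Monotone Q := fun s t hst => Finset.sum_le_sum_of_subset_of_nonneg
    (fun v hv => by
      simp only [Finset.mem_filter, Finset.mem_univ, true_and] at hv ⊢
      omega) fun _ _ _ => NNReal.coe_nonneg _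
  have hQdiff : ∀ s t, s ≤ t → Q t - Q s = ∑ v with s ≤ r v ∧ r v < t, (w v : ℝ) := by
    intro s t hst
    rw [sub_eq_iff_eq_add, hQ, ← Finset.sum_union]
    · refine Finset.sum_congr ?_ fun _ _ => rfl
      ext v
      simp only [Finset.mem_union, Finset.mem_filter, Finset.mem_univ, true_and]
      omega
    · rw [Finset.disjoint_filter]
      omega
  have hQstep : ∀ t, Q (t + 1) - Q t ≤ M := by
    intro t
    rw [hQdiff _ _ t.le_succ]
    refine (Finset.sum_le_card_nsmul _ _ M fun v _ => hwM v).trans ?_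
    have hcard : (Finset.univ.filter fun v => t ≤ r v ∧ r v < t + 1).card ≤ 1 := by
      refine Finset.card_le_one.2 fun u hu v hv => hinj ?_
      simp only [Finset.mem_filter, Finset.mem_univ, true_and] at hu hv
      omega
    rw [nsmul_eq_mul]
    exact mul_le_of_le_one_left hM0 (by exact_mod_cast hcard)
  have hQN : ∀ t, N ≤ t → Q t = Q N := by
    intro t ht
    refine Finset.sum_congr ?_ fun _ _ => rfl
    ext v
    simp only [Finset.mem_filter, Finset.mem_univ, true_and]
    have := hr v
    omega
  -- The prefix weights are continued past `N` with steps `M + ε`, positive even if `M = 0`, to make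
  -- the sequence unbounded. The truncated subtraction leaves the values up to `N` unchanged.
  set P : ℕ → ℝ := fun t => Q t + (t - N : ℕ) * (M + ε) with hPdef
  have hPQ : ∀ t, t ≤ N → P t = Q t := fun t ht => by simp [hPdef, Nat.sub_eq_zero_of_le ht]
  have hP : Monotone P := by
    intro s t hst
    refine add_le_add (hQmono hst) ?_
    gcongr
  have hub : ∀ x, ∃ t, x ≤ P t := by
    intro x
    obtain ⟨n, hn⟩ := exists_nat_gt (x / (M + ε))
    refine ⟨N + n, ?_⟩
    rw [div_lt_iff₀ (by positivity)] at hn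
    have : 0 ≤ Q (N + n) := Finset.sum_nonneg fun _ _ => NNReal.coe_nonneg _
    simp only [hPdef, Nat.add_sub_cancel_left]
    linarith
  have hPstep : ∀ t, P (t + 1) ≤ P t + (M + ε) := by
    intro t
    rcases lt_or_ge t N with ht | ht
    · rw [hPQ t ht.le, hPQ (t + 1) ht]
      linarith [hQstep t]
    · simp only [hPdef]
      rw [hQN t ht, hQN (t + 1) (by omega), show t + 1 - N = (t - N) + 1 by omega]
      push_cast
      linarith
  obtain ⟨s, T, hT0, hTk, hT⟩ := exists_block_partition hub hP hPstep (by positivity) N hk hε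
  have hTN : ∀ i ≤ k, T i ≤ N := by
    intro i hi
    induction hi using Nat.decreasingInduction with
    | self => exact hTk.le
    | of_succ i hi ih => exact ((hT i hi).1).trans ih
  choose χ hχ using fun v => exists_block_of_lt hT0 hTk (hr v)
  have hclass : ∀ i, colorClass χ i =
      Finset.univ.filter fun v => T i ≤ r v ∧ r v < T (i + 1) := by
    intro i
    ext v
    simp only [colorClass, Finset.mem_filter, Finset.mem_univ, true_and]
    constructor
    · rintro rfl
      exact hχ v
    · intro h
      exact block_unique (fun i hi => (hT i hi).1) (hχ v).1 (hχ v).2 h.1 h.2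
  have hweight : ∀ i, (total w (colorClass χ i) : ℝ) = P (T (i + 1)) - P (T i) := by
    intro i
    rw [hPQ _ (hTN _ i.2), hPQ _ (hTN _ i.2.le), hQdiff _ _ (hT i i.2).1, hclass, total]
    push_cast
    rfl
  have hsum : (total w Finset.univ : ℝ) = ∑ i, (total w (colorClass χ i) : ℝ) := by
    rw [total, ← Finset.sum_fiberwise (s := Finset.univ) (g := χ), NNReal.coe_sum]
    refine Finset.sum_congr rfl fun i _ => ?_
    rw [total, colorClass]
  refine ⟨χ, ?_, ?_⟩
  · rw [maxBoundaryCost, maxNorm]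
    refine Finset.sup_le fun i _ => ?_
    have hi := (hT i i.2).1
    -- An edge leaving block `i` crosses the cut at one of its two ends, `T i` or `T (i + 1)`.
    refine le_trans ?_ ((add_le_add (hK (T i)) (hK (T (i + 1)))).trans_eq (two_mul K).symm)
    simp only [layoutCut, Finset.mem_univ, true_and]
    rw [add_comm]
    nth_rewrite 2 [Finset.sum_comm]
    rw [boundaryCost_eq_sum]
    simp only [← Finset.sum_add_distrib]
    refine (Finset.sum_le_sum fun u hu => ?_).trans
      (Finset.sum_le_sum_of_subset (Finset.subset_univ (colorClass χ i)))
    refine (Finset.sum_le_sum fun v hv => ?_).trans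
      (Finset.sum_le_sum_of_subset (Finset.subset_univ (colorClass χ i)ᶜ))
    rw [hclass] at hu hv
    simp only [Finset.mem_compl, Finset.mem_filter, Finset.mem_univ, true_and] at hu hv
    by_cases h1 : T (i + 1) ≤ r v
    · rw [if_pos ⟨hu.2, h1⟩]
      exact le_self_add
    · rw [if_pos (c := r v < T i ∧ T i ≤ r u) (by omega), pairCost_comm]
      exact le_add_self
  · intro i
    rw [hsum]
    refine abs_sub_avg_le (fun i => (total w (colorClass χ i) : ℝ)) _ (fun i j => ?_) i
    simp only [hweight]
    linarith [(hT i i.2).2.2, (hT j j.2).2.1]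

/-- A linear layout all of whose cuts are cheap has strictly balanced colorings by cheap
intervals. -/
lemma exists_strictlyBalanced_of_layout (G : SimpleGraph V) (c : Sym2 V → ℝ≥0) (w : V → ℝ≥0)
    {N : ℕ} {r : V → ℕ} (hr : ∀ v, r v < N) (hinj : Function.Injective r) {K : ℝ≥0}
    (hK : ∀ t, layoutCut G c Finset.univ r t ≤ K) {k : ℕ} (hk : 0 < k) :
    ∃ χ : V → Fin k, StrictlyBalanced w χ ∧ maxBoundaryCost G c χ ≤ 2 * K := by
  classical
  -- `D` measures the total violation of strict balance. There are finitely many colorings, so it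
  -- has a minimiser among the cheap ones; a positive minimum would be halved by the choice `ε = D χ
  -- / (4k)`.
  set D : (V → Fin k) → ℝ := fun χ => ∑ i,
    max 0 (|(total w (colorClass χ i) : ℝ) - (total w Finset.univ : ℝ) / k|
      - (1 - 1 / (k : ℝ)) * (maxNorm w Finset.univ : ℝ)) with hD
  obtain ⟨χ₀, hχ₀, -⟩ := exists_coloring_of_layout G c w hr hinj hK hk one_pos
  obtain ⟨χ, hχ, hmin⟩ := Finset.exists_min_image
    (Finset.univ.filter fun χ : V → Fin k => maxBoundaryCost G c χ ≤ 2 * K) D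
    ⟨χ₀, by simpa using hχ₀⟩
  simp only [Finset.mem_filter, Finset.mem_univ, true_and] at hχ hmin
  have hD0 : D χ ≤ 0 := by
    by_contra! hpos
    have hk' : (0 : ℝ) < k := by exact_mod_cast hk
    obtain ⟨χ', h1, h2⟩ := exists_coloring_of_layout G c w hr hinj hK hk
      (ε := D χ / (4 * k)) (by positivity)
    have h3 : D χ' ≤ ∑ _i : Fin k, 2 * (D χ / (4 * k)) := by
      refine Finset.sum_le_sum fun i _ => max_le (by positivity) ?_
      have h4 : (1 - 1 / (k : ℝ)) * (2 * (D χ / (4 * k))) ≤ 2 * (D χ / (4 * k)) := by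
        refine mul_le_of_le_one_left (by positivity) ?_
        have : 0 ≤ 1 / (k : ℝ) := by positivity
        linarith
      have := h2 i
      rw [mul_add] at this
      linarith
    have h5 : ∑ _i : Fin k, 2 * (D χ / (4 * k)) = D χ / 2 := by
      rw [Finset.sum_const, Finset.card_univ, Fintype.card_fin, nsmul_eq_mul]
      field_simp
      norm_num
    have := hmin χ' h1
    linarith
  refine ⟨χ, fun i => ?_, hχ⟩
  have h1 := Finset.single_le_sum (f := fun i =>
    max 0 (|(total w (colorClass χ i) : ℝ) - (total w Finset.univ : ℝ) / k|
      - (1 - 1 / (k : ℝ)) * (maxNorm w Finset.univ : ℝ))) (fun _ _ => le_max_left _ _)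
    (Finset.mem_univ i)
  have h2 := (le_max_right 0 _).trans (h1.trans hD0)
  linarith

end Intervals

/-! ### The two-sided estimates on the copies. -/

section Bounds

variable {V : Type*} [Fintype V]

lemma pNorm_copiesCost (m : ℕ) (G : SimpleGraph V) (c : Sym2 V → ℝ≥0) {p : ℝ} (hp : 0 < p) :
    pNorm p (copiesCost m c) (edges (copies m G)) = (m : ℝ≥0) ^ (1 / p) * pNorm p c (edges G) := by
  rw [pNorm, pNorm, ← NNReal.mul_rpow]
  congr 1
  refine mul_left_cancel₀ (two_ne_zero (α := ℝ≥0)) ?_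
  rw [← sum_sum_pairCost_rpow _ _ hp, mul_left_comm, ← sum_sum_pairCost_rpow _ _ hp,
    Fintype.sum_prod_type]
  simp only [Fintype.sum_prod_type, pairCost_copies]
  have : ∀ i : Fin m, ∑ u, ∑ j : Fin m, ∑ v, (if i = j then pairCost G c u v else 0) ^ p =
      ∑ u, ∑ v, pairCost G c u v ^ p := by
    intro i
    refine Finset.sum_congr rfl fun u _ => ?_
    rw [Finset.sum_eq_single i
      (fun j _ hj => by simp [hj.symm, NNReal.zero_rpow hp.ne']) (by simp)]
    simp
  rw [Finset.sum_congr rfl fun i _ => this i]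
  simp

lemma maxNorm_copiesCost_le (m : ℕ) (G : SimpleGraph V) (c : Sym2 V → ℝ≥0) {p : ℝ} (hp : 0 < p) :
    maxNorm (copiesCost m c) (edges (copies m G)) ≤ pNorm p c (edges G) := by
  classical
  refine Finset.sup_le fun e he => ?_
  induction e with | _ x y =>
  have hadj : (copies m G).Adj x y := by simpa [edges] using he
  have hmem : s(x.2, y.2) ∈ edges G := by simpa [edges] using hadj.2
  rw [← NNReal.rpow_le_rpow_iff hp, pNorm_rpow hp]
  exact Finset.single_le_sum (f := fun e => c e ^ p) (fun _ _ => zero_le) hmem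

lemma quarter_mul_pNorm_le_costBound {k : ℕ} (hk : 0 < k) (h4 : 4 ∣ k) (G : SimpleGraph V)
    (c : Sym2 V → ℝ≥0) {p : ℝ} (hp : 1 < p) :
    1 / 4 * pNorm p c (edges G) ≤ costBound p k (copies (k / 4) G) (copiesCost (k / 4) c) ∧
    costBound p k (copies (k / 4) G) (copiesCost (k / 4) c) ≤ 2 * pNorm p c (edges G) := by
  have hp0 : 0 < p := by linarith
  obtain ⟨m, rfl⟩ := h4
  have hm : (m : ℝ≥0) ≠ 0 := by
    have : m ≠ 0 := by omega
    exact_mod_cast this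
  -- The factor `m^(1/p)` cancels against `k^(1/p)`, leaving `(1/4)^(1/p)`, which lies between `1/4`
  -- and `1`.
  have h1 : pNorm p (copiesCost m c) (edges (copies m G)) / ((4 * m : ℕ) : ℝ≥0) ^ (1 / p) =
      (1 / 4) ^ (1 / p) * pNorm p c (edges G) := by
    rw [pNorm_copiesCost m G c hp0, mul_div_right_comm, ← NNReal.div_rpow]
    congr 2
    push_cast
    field_simp
  have hq : (1 / 4 : ℝ≥0) ≤ (1 / 4) ^ (1 / p) := by
    have := Real.self_le_rpow_of_le_one (x := 1 / 4) (y := 1 / p) (by norm_num) (by norm_num)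
      (by rw [div_le_one hp0]; exact hp.le)
    rw [← NNReal.coe_le_coe]
    push_cast
    exact this
  have hq1 : ((1 / 4 : ℝ≥0)) ^ (1 / p) ≤ 1 :=
    NNReal.rpow_le_one (by rw [← NNReal.coe_le_coe]; push_cast; norm_num) (by positivity)
  rw [Nat.mul_div_cancel_left m (by norm_num), costBound, h1]
  constructor
  · exact (mul_le_mul_left hq _).trans le_self_add
  · rw [two_mul]
    exact add_le_add (mul_le_of_le_one_left' hq1) (maxNorm_copiesCost_le m G c hp0)

/-- For `k = 4m` the average class weight is `‖w‖₁ / 4`, and the permitted deviation `‖w‖_∞` is at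
most as large. -/
lemma roughlyBalanced_of_strictlyBalanced {m : ℕ} (hm : 0 < m) {w : V → ℝ≥0}
    (hw : maxNorm w Finset.univ ≤ total w Finset.univ / 4) {χ : Fin m × V → Fin (4 * m)}
    (h : StrictlyBalanced (copiesWeight m w) χ) : RoughlyBalanced (copiesWeight m w) χ := by
  intro i
  have h1 := (abs_le.1 (h i)).2
  have hm' : (0 : ℝ) < m := by exact_mod_cast hm
  have hmax : maxNorm (copiesWeight m w) Finset.univ ≤ total w Finset.univ / 4 :=
    le_trans (Finset.sup_le fun x _ => Finset.le_sup (f := w) (Finset.mem_univ x.2)) hw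
  rw [total_copiesWeight] at h1 ⊢
  rw [← NNReal.coe_le_coe] at hmax ⊢
  push_cast at h1 hmax ⊢
  have h2 : (m : ℝ) * (total w Finset.univ) / (4 * m) = (total w Finset.univ : ℝ) / 4 := by
    field_simp
  have h3 : (1 - 1 / (4 * (m : ℝ))) * (maxNorm (copiesWeight m w) Finset.univ : ℝ) ≤
      maxNorm (copiesWeight m w) Finset.univ := by
    refine mul_le_of_le_one_left (NNReal.coe_nonneg _) ?_
    have : 0 ≤ 1 / (4 * (m : ℝ)) := by positivity
    linarith
  rw [h2] at h1 ⊢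
  linarith

open Classical in
/-- Roughly balanced colorings split each of the copies, at the cost of a balanced separation. -/
lemma le_avgBoundaryCost {m : ℕ} (hm : 0 < m) (G : SimpleGraph V) (c : Sym2 V → ℝ≥0) {Δ : ℕ}
    {φ : ℝ≥0} (h : WellBehaved G c Δ φ) (w : V → ℝ≥0) (x : ℝ≥0)
    (hx : ∀ A B : Finset V, IsBalancedSeparation G Finset.univ w A B →
      x ≤ separationCost (vertexCost G c) A B) {χ : Fin m × V → Fin (4 * m)}
    (hχ : RoughlyBalanced (copiesWeight m w) χ) :
    x ≤ 4 * φ * avgBoundaryCost (copies m G) (copiesCost m c) χ := by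
  have hm' : (m : ℝ≥0) ≠ 0 := by exact_mod_cast hm.ne'
  have hcopy : ∀ j : Fin m,
      x ≤ φ * ∑ u, ∑ v, if χ (j, u) = χ (j, v) then 0 else pairCost G c u v := by
    intro j
    convert separation_le_cut_of_labels G c h w x hx (fun v => χ (j, v)) fun i => ?_ using 8
    have h1 : total w (Finset.univ.filter fun v => χ (j, v) = i) ≤
        total (copiesWeight m w) (colorClass χ i) := by
      have : total w (Finset.univ.filter fun v => χ (j, v) = i) =
          total (copiesWeight m w) ((Finset.univ.filter fun v => χ (j, v) = i).map
            ⟨fun v => (j, v), Prod.mk_right_injective j⟩) := by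
        simp [total, copiesWeight]
      rw [this]
      refine Finset.sum_le_sum_of_subset fun y hy => ?_
      obtain ⟨v, hv, rfl⟩ := Finset.mem_map.1 hy
      simpa [colorClass] using hv
    have h3 := h1.trans (hχ i)
    rw [total_copiesWeight] at h3
    -- Twice the average class weight is half the weight of one copy, below the two thirds that a
    -- separation allows.
    have h2 : 2 * (m * total w Finset.univ / ((4 * m : ℕ) : ℝ≥0)) =
        1 / 2 * total w Finset.univ := by
      push_cast
      field_simp
      ring
    rw [h2] at h3
    refine le_trans (le_of_eq ?_) (h3.trans (mul_le_mul_left ?_ _))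
    · congr!
    rw [← NNReal.coe_le_coe]
    push_cast
    norm_num
  have hsum : ∑ i, boundaryCost (copies m G) (copiesCost m c) (colorClass χ i) =
      ∑ j : Fin m, ∑ u, ∑ v, if χ (j, u) = χ (j, v) then 0 else pairCost G c u v := by
    rw [sum_boundaryCost_colorClass, Fintype.sum_prod_type]
    refine Finset.sum_congr rfl fun j _ => Finset.sum_congr rfl fun u _ => ?_
    rw [Fintype.sum_prod_type, Finset.sum_eq_single j
      (fun i _ hi => by simp [pairCost_copies, hi.symm]) (by simp)]
    simp [pairCost_copies]
  have htot : m * x ≤ φ * ∑ i, boundaryCost (copies m G) (copiesCost m c) (colorClass χ i) := by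
    rw [hsum, Finset.mul_sum]
    calc m * x = ∑ _j : Fin m, x := by simp
      _ ≤ _ := Finset.sum_le_sum fun j _ => hcopy j
  rw [avgBoundaryCost, total]
  have h3 : 4 * φ * ((∑ i, boundaryCost (copies m G) (copiesCost m c) (colorClass χ i)) /
      ((4 * m : ℕ) : ℝ≥0)) =
      (φ * ∑ i, boundaryCost (copies m G) (copiesCost m c) (colorClass χ i)) / m := by
    push_cast
    field_simp
  rw [h3, le_div_iff₀ (by positivity), mul_comm]
  exact htot

lemma avgBoundaryCost_le_maxBoundaryCost {k : ℕ} (hk : 0 < k) (G : SimpleGraph V)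
    (c : Sym2 V → ℝ≥0) (χ : V → Fin k) : avgBoundaryCost G c χ ≤ maxBoundaryCost G c χ := by
  have hk' : (0 : ℝ≥0) < k := by exact_mod_cast hk
  rw [avgBoundaryCost, div_le_iff₀ hk', total]
  refine (Finset.sum_le_card_nsmul _ _ _ fun i hi =>
    Finset.le_sup (f := fun i => boundaryCost G c (colorClass χ i)) hi).trans_eq ?_
  rw [Finset.card_univ, Fintype.card_fin, nsmul_eq_mul, mul_comm]
  rfl

/-- The factor 2 counts the two ends of an interval. The bound involves neither `k` nor `m`, as a
cut of the concatenated layouts splits at most one copy. -/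
lemma decompositionCost_copies_le {k m : ℕ} (hk : 0 < k) (G : SimpleGraph V) (c : Sym2 V → ℝ≥0)
    {p : ℝ} (hp : 0 < p) {β C : ℝ≥0} (h : separability p G (vertexCost G c) ≤ β)
    (hC : 2 * β + (2 / 3) ^ (1 / p) * C ≤ C) :
    decompositionCost k (copies m G) (copiesCost m c) ≤
      (2 * (C * pNorm p (vertexCost G c) Finset.univ) : ℝ≥0) := by
  obtain ⟨N, r, hr, hinj, hcut⟩ := exists_layout G c hp h hC _ Finset.univ rfl
  have hr' : ∀ v, r v < N := fun v => hr v (Finset.mem_univ v)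
  refine iSup_le fun w => ?_
  have hlt : ∀ x : Fin m × V, x.1 * N + r x.2 < m * N := by
    intro x
    have h1 := hr' x.2
    have h2 : (x.1 + 1 : ℕ) * N ≤ m * N := Nat.mul_le_mul_right N x.1.2
    rw [add_mul] at h2
    omega
  have hinj' : Function.Injective fun x : Fin m × V => x.1 * N + r x.2 := by
    intro x y hxy
    have hdiv : ∀ z : Fin m × V, (z.1 * N + r z.2) / N = z.1 := by
      intro z
      have := hr' z.2
      rw [Nat.div_eq_iff (by omega)]
      omega
    have h1 : (x.1 : ℕ) = y.1 := by
      rw [← hdiv x, ← hdiv y]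
      exact congrArg (· / N) hxy
    have h2 : r x.2 = r y.2 := by
      simp only [h1] at hxy
      omega
    exact Prod.ext (Fin.ext h1) (hinj (by simp) (by simp) h2)
  obtain ⟨χ, h1, h2⟩ := exists_strictlyBalanced_of_layout (copies m G) (copiesCost m c) w
    hlt hinj' (layoutCut_copies_le m G c hr' hcut) hk
  exact iInf₂_le_of_le χ h1 (by exact_mod_cast h2)

end Bounds

end MinMaxBoundary

theorem mainTheorem10 (Δ : ℕ) (φ β b : ℝ≥0) (hb : 0 < b) :
    ∃ C₀ : ℝ≥0, 0 < C₀ ∧ ∀ p : ℝ, 1 < p →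
    ∃ β' C₁ C₂ : ℝ≥0, 0 < C₁ ∧
    ∀ (V : Type*) [Fintype V] (G : SimpleGraph V) (c : Sym2 V → ℝ≥0) (w : V → ℝ≥0),
      WellBehaved G c Δ φ →
      separability p G (vertexCost G c) ≤ β →
      maxNorm w Finset.univ ≤ total w Finset.univ / 4 →
      (∀ A B : Finset V, IsBalancedSeparation G Finset.univ w A B →
        b * pNorm p (vertexCost G c) Finset.univ ≤ separationCost (vertexCost G c) A B) →
      ∀ k : ℕ, 0 < k → 4 ∣ k →
        WellBehaved (copies (k / 4) G) (copiesCost (k / 4) c) Δ φ ∧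
        separability p (copies (k / 4) G)
          (vertexCost (copies (k / 4) G) (copiesCost (k / 4) c)) ≤ β' ∧
        (C₁ * costBound p k (copies (k / 4) G) (copiesCost (k / 4) c) : ℝ≥0)
          ≤ decompositionCost k (copies (k / 4) G) (copiesCost (k / 4) c) ∧
        decompositionCost k (copies (k / 4) G) (copiesCost (k / 4) c)
          ≤ (C₂ * costBound p k (copies (k / 4) G) (copiesCost (k / 4) c) : ℝ≥0) ∧
        ∀ χ : Fin (k / 4) × V → Fin k, RoughlyBalanced (copiesWeight (k / 4) w) χ →
          C₀ * costBound p k (copies (k / 4) G) (copiesCost (k / 4) c)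
            ≤ avgBoundaryCost (copies (k / 4) G) (copiesCost (k / 4) c) χ := by
  -- The 8 combines `k = 4m` with the cost bound being at most `2 ‖c‖_p`; `φ + 1` keeps the
  -- denominator positive. Nothing here depends on `p`.
  refine ⟨b / (8 * (φ + 1)), by positivity, fun p hp => ?_⟩
  have hp0 : 0 < p := by linarith
  have hq : ((2 / 3 : ℝ≥0)) ^ (1 / p) < 1 :=
    NNReal.rpow_lt_one (by rw [← NNReal.coe_lt_coe]; push_cast; norm_num) (by positivity)
  -- The sum of the geometric series, `C = 2β / (1 - q)` with `q = (2/3)^(1/p)`.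
  obtain ⟨C, hC⟩ : ∃ C : ℝ≥0, 2 * β + (2 / 3) ^ (1 / p) * C ≤ C := by
    set q : ℝ≥0 := (2 / 3) ^ (1 / p)
    obtain ⟨d, hd⟩ := exists_add_of_le hq.le
    have hd0 : d ≠ 0 := by
      rintro rfl
      rw [add_zero] at hd
      exact hq.ne hd.symm
    refine ⟨2 * β / d, le_of_eq ?_⟩
    calc 2 * β + q * (2 * β / d) = (q + d) * (2 * β / d) := by
          rw [add_mul, mul_div_cancel₀ _ hd0, add_comm]
      _ = 2 * β / d := by rw [← hd, one_mul]
  -- The factors of `C₂` are the two ends of an interval, the layout constant `C`, the ratio `2(Δ +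
  -- 1)` of `‖τ‖_p` to `‖c‖_p`, and the 4 relating `‖c‖_p` to the cost bound.
  refine ⟨β, b / (8 * (φ + 1)), 2 * (C * (2 * (Δ + 1) * 4)), by positivity, ?_⟩
  intro V _ G c w hwb hsep hw hbal k hk hk4
  obtain ⟨hlow, hup⟩ := quarter_mul_pNorm_le_costBound hk hk4 G c hp
  have havg : ∀ χ : Fin (k / 4) × V → Fin k, RoughlyBalanced (copiesWeight (k / 4) w) χ →
      b / (8 * (φ + 1)) * costBound p k (copies (k / 4) G) (copiesCost (k / 4) c)
        ≤ avgBoundaryCost (copies (k / 4) G) (copiesCost (k / 4) c) χ := by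
    obtain ⟨m, rfl⟩ := hk4
    rw [Nat.mul_div_cancel_left m (by norm_num)] at hup ⊢
    intro χ hχ
    have h1 := le_avgBoundaryCost (by omega) G c hwb w _ hbal hχ
    rw [div_mul_eq_mul_div, div_le_iff₀ (by positivity)]
    calc b * costBound p (4 * m) (copies m G) (copiesCost m c)
        ≤ b * (2 * pNorm p (vertexCost G c) Finset.univ) := by
          gcongr
          exact hup.trans (mul_le_mul_right (pNorm_edges_le G c hp) _)
      _ = 2 * (b * pNorm p (vertexCost G c) Finset.univ) := by ring
      _ ≤ 2 * (4 * φ * avgBoundaryCost (copies m G) (copiesCost m c) χ) := by gcongr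
      _ = avgBoundaryCost (copies m G) (copiesCost m c) χ * (8 * φ) := by ring
      _ ≤ avgBoundaryCost (copies m G) (copiesCost m c) χ * (8 * (φ + 1)) := by
          gcongr
          exact le_self_add
  refine ⟨wellBehaved_copies _ G c hwb, separability_copies _ G c hp0 hsep, ?_, ?_, havg⟩
  · refine le_iSup_of_le (copiesWeight (k / 4) w) (le_iInf₂ fun χ hχ => ?_)
    refine ENNReal.coe_le_coe.2 ((havg χ ?_).trans (avgBoundaryCost_le_maxBoundaryCost hk _ _ χ))
    obtain ⟨m, rfl⟩ := hk4
    revert χ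
    rw [Nat.mul_div_cancel_left m (by norm_num)]
    exact fun χ hχ => roughlyBalanced_of_strictlyBalanced (by omega) hw hχ
  · refine (decompositionCost_copies_le hk G c hp0 hsep hC).trans (ENNReal.coe_le_coe.2 ?_)
    have h1 := pNorm_vertexCost_le G c hp hwb.1
    have h2 : pNorm p c (edges G) ≤
        4 * costBound p k (copies (k / 4) G) (copiesCost (k / 4) c) := by
      calc pNorm p c (edges G) = 4 * (1 / 4 * pNorm p c (edges G)) := by
            rw [← mul_assoc]; norm_num
        _ ≤ _ := by gcongr
    calc 2 * (C * pNorm p (vertexCost G c) Finset.univ)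
        ≤ 2 * (C * (2 * (Δ + 1) *
            (4 * costBound p k (copies (k / 4) G) (copiesCost (k / 4) c)))) := by
          gcongr
          exact h1.trans (mul_le_mul_right h2 _)
      _ = _ := by ring
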